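/- Let $n\ge 3$, let $S^{n-1}$ be the unit sphere of $\mathbb R^n$ with surface measure $d\omega_n$ of total mass $\omega_n$ (and likewise $\omega_m$ for $S^{m-1}$), and let $(f,g)=\frac1{\omega_n}\int_{S^{n-1}}f(x)g(x)\,d\omega_n(x)$. Let $\mathrm{Harm}_k^m$ be the space of real homogeneous harmonic polynomials of degree $k$ in $m$ variables, $h_k^m=\dim \mathrm{Harm}_k^m$, and let $H_i^n$ be the space of restrictions to $S^{n-1}$ of the elements of $\mathrm{Harm}_i^n$. Fix $e\in S^{n-1}$ and let $H$ be the stabilizer of $e$ in the orthogonal group $\mathrm O(\mathbb R^n)$, so that $H\simeq \mathrm O(e^\perp)\simeq \mathrm O(\mathbb R^{n-1})$. For $0\le k\le i$ let $H_{k,i}^{n-1}$ be the unique subspace of $H_i^n$ isomorphic to $\mathrm{Harm}_k^{n-1}$ as a representation of $H$. Fix $d\ge 0$. For each $0\le k\le d$ and $0\le s\le d-k$ let $(e_{s,m}^k)_{1\le m\le h_k^{n-1}}$ be an orthonormal basis of $H_{k,k+s}^{n-1}$ which is the image of $(e_{0,m}^k)_m$ under some $H$-isomorphism $H_{k,k}^{n-1}\to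 H_{k,k+s}^{n-1}$. Put $E_k^n(x)=\frac1{\sqrt{h_k^{n-1}}}\big(e_{s,m}^k(x)\big)_{0\le s\le d-k,\ 1\le m\le h_k^{n-1}}$ and let $Y_k^n=Y_k^n(u,v,t)$ be the $(d-k+1)\times(d-k+1)$ matrix with entries in $\mathbb R[u,v,t]$, indexed by $0\le i,j\le d-k$, such that $$E_k^n(x)\,E_k^n(y)^t=Y_k^n(e\cdot x,\ e\cdot y,\ x\cdot y)\qquad\text{for all }x,y\in S^{n-1}.$$ Let $\overline Y_k^n(u,v,t)=\frac12\big(Y_k^n(u,v,t)+Y_k^n(v,u,t)\big)$ and $\langle A,B\rangle=\mathrm{Trace}(AB^t)$. For $F,G\in\mathbb R[u,v,t]$ let $$[F,G]=\int_\Omega F(u,v,t)\,G(u,v,t)\,\frac{\omega_{n-1}\omega_{n-2}}{\omega_n^2}\,(1-u^2-v^2-t^2+2uvt)^{\frac{n-4}2}\,du\,dv\,dt,$$ $$\Omega=\{(u,v,t): -1\le u,v,t\le 1,\ 1+2uvt-u^2-v^2-t^2\ge 0\}.$$ Then: (a) For all $0\le k,k'\le d$, all $0\le i,j\le d-k$ and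 all $0\le i',j'\le d-k'$, $$[(Y_k^n)_{i,j},(Y_{k'}^n)_{i',j'}]=\frac{\delta_{(i,j,k),(i',j',k')}}{h_k^{n-1}}.$$ (b) For all $0\le k,k'\le d$ and all real symmetric matrices $A$ of size $d-k+1$ and $B$ of size $d-k'+1$: if $k=k'$ then $$[\langle A,\overline Y_k^n\rangle,\langle B,\overline Y_k^n\rangle]=\frac{\langle A,B\rangle}{h_k^{n-1}},$$ and if $k\ne k'$ then $[\langle A,\overline Y_k^n\rangle,\langle B,\overline Y_{k'}^n\rangle]=0$. -/

import Mathlib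

open MeasureTheory
open scoped RealInnerProductSpace

noncomputable section

namespace CapCode

/-- The Euclidean space `ℝⁿ`. -/
abbrev Euc (n : ℕ) : Type := EuclideanSpace ℝ (Fin n)

/-- The unit sphere `S^{n-1}` of `ℝⁿ`. -/
abbrev Sph (n : ℕ) : Type := Metric.sphere (0 : Euc n) 1

/-- The (unnormalized) surface measure `dω_n` of `S^{n-1}`. -/
def sphMeasure (n : ℕ) : Measure (Sph n) := (volume : Measure (Euc n)).toSphere

/-- The surface area `ω_n` of `S^{n-1}`. -/
def omega (n : ℕ) : ℝ := (sphMeasure n).real Set.univ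

/-- `(f, g) = (1 / ω_n) ∫ f(x) g(x) dω_n(x)` over the sphere `S^{n-1}`. -/
def sphInner (n : ℕ) (f g : Sph n → ℝ) : ℝ :=
  (1 / omega n) * ∫ x, f x * g x ∂(sphMeasure n)

/-! ### Harmonic polynomials -/

/-- The Laplace operator `∑ ∂² / ∂x_i²` on real polynomials in `n` variables. -/
def laplacian (n : ℕ) : MvPolynomial (Fin n) ℝ →ₗ[ℝ] MvPolynomial (Fin n) ℝ :=
  ∑ i, (MvPolynomial.pderiv i).toLinearMap ∘ₗ (MvPolynomial.pderiv i).toLinearMap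

/-- `Harm_k^n`: the homogeneous harmonic polynomials of degree `k` in `n` variables. -/
def harm (n k : ℕ) : Submodule ℝ (MvPolynomial (Fin n) ℝ) :=
  MvPolynomial.homogeneousSubmodule (Fin n) ℝ k ⊓ LinearMap.ker (laplacian n)

/-- `h_k^n = dim Harm_k^n`. -/
def harmDim (n k : ℕ) : ℕ := Module.finrank ℝ (harm n k)

/-- The polynomial function on `ℝⁿ` given by `p`. -/
def evalAt {n : ℕ} (x : Euc n) (p : MvPolynomial (Fin n) ℝ) : ℝ :=
  MvPolynomial.eval (fun i => x i) p

/-- Restriction of polynomials to the sphere, as a linear map into the functions on the sphere. -/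
def restrictSph (n : ℕ) : MvPolynomial (Fin n) ℝ →ₗ[ℝ] (Sph n → ℝ) where
  toFun p := fun x => evalAt (x : Euc n) p
  map_add' p q := by funext x; simp [evalAt]
  map_smul' c p := by funext x; simp [evalAt]

/-- `H_k^n`: the spherical harmonics of degree `k` on `S^{n-1}`, a space of functions on the
sphere. -/
def sphHarm (n k : ℕ) : Submodule ℝ (Sph n → ℝ) := (harm n k).map (restrictSph n)

/-! ### The action of the stabilizer `H` of `e` -/

/-- The action of the orthogonal group on the sphere. -/
def rot {n : ℕ} (g : Euc n ≃ₗᵢ[ℝ] Euc n) (x : Sph n) : Sph n :=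
  ⟨g x, by simp⟩

/-- `W` is a subspace of `H_i^n` which is isomorphic to `Harm_k^{n-1}` as a representation of
`H = Stab(e, O(ℝⁿ))`. The group `H` acts on functions on `S^{n-1}` by substitution; it acts on
polynomials in `n - 1` variables through `H ≃ O(e^⊥) ≃ O(ℝ^{n-1})`, the last identification being
given by an isometry `ι` of `ℝ^{n-1}` onto the hyperplane `e^⊥`. Here `g'` is the element of
`O(ℝ^{n-1})` corresponding to `g ∈ H`, and the polynomial `q` is `p ∘ g'`. -/
def IsCopyOfHarm (n : ℕ) (e : Euc n) (k i : ℕ) (W : Submodule ℝ (Sph n → ℝ)) : Prop :=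
  W ≤ sphHarm n i ∧
  ∃ ι : Euc (n - 1) →ₗᵢ[ℝ] Euc n, (∀ z, ⟪e, ι z⟫ = 0) ∧
  ∃ φ : harm (n - 1) k ≃ₗ[ℝ] W,
    ∀ g : Euc n ≃ₗᵢ[ℝ] Euc n, g e = e →
    ∀ g' : Euc (n - 1) ≃ₗᵢ[ℝ] Euc (n - 1), (∀ z, g (ι z) = ι (g' z)) →
    ∀ p q : harm (n - 1) k,
      (∀ z, evalAt z (q : MvPolynomial (Fin (n - 1)) ℝ)
        = evalAt (g' z) (p : MvPolynomial (Fin (n - 1)) ℝ)) →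
      ∀ x : Sph n, (φ q : Sph n → ℝ) x = (φ p : Sph n → ℝ) (rot g x)

/-- `H_{k,i}^{n-1}`: the subspace of `H_i^n` isomorphic to `Harm_k^{n-1}` as a representation of
`H`. For `n ≥ 3`, `k ≤ i` and a unit vector `e` there is exactly one such subspace, so that the
supremum is that subspace. -/
def subHarm (n : ℕ) (e : Euc n) (k i : ℕ) : Submodule ℝ (Sph n → ℝ) :=
  sSup {W | IsCopyOfHarm n e k i W}

/-- A linear isomorphism between spaces of functions on the sphere commutes with the action of
`H = Stab(e, O(ℝⁿ))`. -/
def IsEquivariant {n : ℕ} (e : Euc n) {V W : Submodule ℝ (Sph n → ℝ)} (φ : V ≃ₗ[ℝ] W) : Prop :=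
  ∀ g : Euc n ≃ₗᵢ[ℝ] Euc n, g e = e →
    ∀ f f' : V, (∀ x, (f' : Sph n → ℝ) x = (f : Sph n → ℝ) (rot g x)) →
      ∀ x, (φ f' : Sph n → ℝ) x = (φ f : Sph n → ℝ) (rot g x)

/-- The functions `b s m = e_{s,m}^k` are an admissible choice of bases: for each `0 ≤ s ≤ d - k`
the family `b s` is an orthonormal basis of `H_{k,k+s}^{n-1}`, and it is the image of `b 0` under
some `H`-isomorphism from `H_{k,k}^{n-1}` to `H_{k,k+s}^{n-1}`. -/
structure IsAdaptedBasis (n : ℕ) (e : Euc n) (d k : ℕ)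
    (b : Fin (d - k + 1) → Fin (harmDim (n - 1) k) → Sph n → ℝ) : Prop where
  orthonormal : ∀ (s : Fin (d - k + 1)) m m', sphInner n (b s m) (b s m') = if m = m' then 1 else 0
  span_eq : ∀ s : Fin (d - k + 1), Submodule.span ℝ (Set.range (b s)) = subHarm n e k (k + (s : ℕ))
  transported : ∀ s : Fin (d - k + 1), ∃ φ : subHarm n e k k ≃ₗ[ℝ] subHarm n e k (k + (s : ℕ)),
    IsEquivariant e φ ∧
    ∀ m, ∀ f : subHarm n e k k, (f : Sph n → ℝ) = b 0 m → (φ f : Sph n → ℝ) = b s m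

/-! ### The zonal matrices -/

/-- The matrix `E_k^n(x) = (h_k^{n-1})^{-1/2} (e_{s,m}^k(x))_{s,m}`. -/
def EMat {n d k : ℕ} (b : Fin (d - k + 1) → Fin (harmDim (n - 1) k) → Sph n → ℝ) (x : Sph n) :
    Matrix (Fin (d - k + 1)) (Fin (harmDim (n - 1) k)) ℝ :=
  (1 / Real.sqrt (harmDim (n - 1) k)) • Matrix.of fun s m => b s m x

/-- The matrix `Z_k^n(x, y) = E_k^n(x) E_k^n(y)ᵗ`. -/
def ZMat {n d k : ℕ} (b : Fin (d - k + 1) → Fin (harmDim (n - 1) k) → Sph n → ℝ) (x y : Sph n) :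
    Matrix (Fin (d - k + 1)) (Fin (d - k + 1)) ℝ :=
  EMat b x * (EMat b y).transpose

/-- The ring `ℝ[u, v, t]`, with `u`, `v`, `t` the variables of index `0`, `1`, `2`. -/
abbrev Poly3 : Type := MvPolynomial (Fin 3) ℝ

/-- `Y` is the matrix `Y_k^n` of polynomials in `u, v, t` belonging to an admissible choice of
bases: `Z_k^n(x, y) = Y_k^n(e·x, e·y, x·y)` for all `x, y ∈ S^{n-1}`. -/
def IsZonalMatrix (n : ℕ) (e : Euc n) (d k : ℕ)
    (Y : Matrix (Fin (d - k + 1)) (Fin (d - k + 1)) Poly3) : Prop :=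
  ∃ b : Fin (d - k + 1) → Fin (harmDim (n - 1) k) → Sph n → ℝ,
    IsAdaptedBasis n e d k b ∧
    ∀ x y : Sph n, ZMat b x y =
      Y.map (MvPolynomial.eval ![⟪e, (x : Euc n)⟫, ⟪e, (y : Euc n)⟫, ⟪(x : Euc n), (y : Euc n)⟫])

/-- The symmetric matrix `Ȳ(u,v,t) = (Y(u,v,t) + Y(v,u,t)) / 2`. -/
def symmetrized {N : ℕ} (Y : Matrix (Fin N) (Fin N) Poly3) : Matrix (Fin N) (Fin N) Poly3 :=
  (1 / 2 : ℝ) • (Y + Y.map (MvPolynomial.rename (Equiv.swap (0 : Fin 3) 1)))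

/-- `⟨A, B⟩ = Trace(A Bᵗ)`. -/
def matInner {N : ℕ} {R : Type} [CommRing R] (A B : Matrix (Fin N) (Fin N) R) : R :=
  (A * B.transpose).trace

/-- A real matrix as a matrix of constant polynomials. -/
def constMat {N : ℕ} (A : Matrix (Fin N) (Fin N) ℝ) : Matrix (Fin N) (Fin N) Poly3 :=
  A.map MvPolynomial.C

/-! ### The induced scalar product on `ℝ[u, v, t]` -/

/-- The domain `Ω` of all triples `(u, v, t)` with `-1 ≤ u, v, t ≤ 1` and
`1 + 2uvt - u² - v² - t² ≥ 0`. -/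
def Omega : Set (ℝ × ℝ × ℝ) :=
  {w | w.1 ∈ Set.Icc (-1) 1 ∧ w.2.1 ∈ Set.Icc (-1) 1 ∧ w.2.2 ∈ Set.Icc (-1) 1 ∧
    0 ≤ 1 + 2 * w.1 * w.2.1 * w.2.2 - w.1 ^ 2 - w.2.1 ^ 2 - w.2.2 ^ 2}

/-- The weight
`k(u,v,t) = (ω_{n-1} ω_{n-2} / ω_n²) (1 - u² - v² - t² + 2uvt)^{(n-4)/2}`. -/
def weight (n : ℕ) (w : ℝ × ℝ × ℝ) : ℝ :=
  omega (n - 1) * omega (n - 2) / omega n ^ 2 *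
    (1 - w.1 ^ 2 - w.2.1 ^ 2 - w.2.2 ^ 2 + 2 * w.1 * w.2.1 * w.2.2) ^ (((n : ℝ) - 4) / 2)

/-- `[F, G] = ∫_Ω F(u,v,t) G(u,v,t) k(u,v,t) du dv dt`. -/
def polyInner (n : ℕ) (F G : Poly3) : ℝ :=
  ∫ w in Omega,
    MvPolynomial.eval ![w.1, w.2.1, w.2.2] F * MvPolynomial.eval ![w.1, w.2.1, w.2.2] G *
      weight n w

end CapCode

end

/-! The weight is the joint density of $(e\cdot x, e\cdot y, x\cdot y)$ for independent uniform
points $x, y$ of the sphere (`map_innerTriple`). Hence $[F,G]$ is the normalized double integral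
over $S^{n-1}\times S^{n-1}$ of $F$ and $G$ evaluated at these inner products
(`polyInner_eq_integral`). The density comes from one slicing formula, `lintegral_sphere_slice`: it
gives the law of $e\cdot x$, and, for fixed $x$, the law of two orthogonal coordinates of $y$, from
which that of $(e\cdot y, x\cdot y)$ follows.

On the sphere an entry of $Y_k^n$ is $h^{-1}\sum_m e_{i,m}(x)e_{j,m}(y)$, so the double integral
splits into products of scalar products of the $e_{s,m}^k$, and the theorem follows once all these
functions, over all $k,s,m$, are orthonormal. For equal $k$ and $s$ this is the choice of basis. For
equal $k$ and different $s$ the functions are spherical harmonics of different degrees. For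
different $k$ they lie in copies of harmonic spaces of different degrees in $n-1$ variables. Both
orthogonalities come from `invariant_pairing_eq_zero`: an invariant pairing makes the Casimir
operator of the rotations self-adjoint, and its eigenvalues on different degrees are different.

Part (b) reduces to the same computation, because $\langle A,\overline Y\rangle$ and $\langle
A,Y\rangle$ agree on the sphere for symmetric $A$. -/

noncomputable section

namespace CapCode

/-! ### Projections of the surface measure onto a linear factor. -/

section Slicing

open Set Measure

instance isFiniteMeasure_sphMeasure (n : ℕ) : IsFiniteMeasure (sphMeasure n) := by
  unfold sphMeasure
  infer_instance

/-- Integration in polar coordinates. -/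
theorem lintegral_polar {E : Type*} [NormedAddCommGroup E] [NormedSpace ℝ E] [MeasurableSpace E]
    [BorelSpace E] [FiniteDimensional ℝ E] [Nontrivial E] (μ : Measure E) [μ.IsAddHaarMeasure]
    {f : E → ENNReal} (hf : Measurable f) :
    ∫⁻ x, f x ∂μ = ∫⁻ s : Metric.sphere (0 : E) 1,
      (∫⁻ r in Ioi (0 : ℝ), ENNReal.ofReal (r ^ (Module.finrank ℝ E - 1)) * f (r • (s : E)))
        ∂μ.toSphere := by
  have h1 : ∫⁻ x, f x ∂μ = ∫⁻ x : ({(0)}ᶜ : Set E), f x ∂(μ.comap (↑)) := by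
    rw [lintegral_subtype_comap (measurableSet_singleton _).compl, restrict_compl_singleton]
  have h2 := μ.measurePreserving_homeomorphUnitSphereProd.symm
    (homeomorphUnitSphereProd E).toMeasurableEquiv
  have h3 := h2.lintegral_comp_emb (MeasurableEquiv.measurableEmbedding _)
    (fun x : ({(0)}ᶜ : Set E) => f x)
  rw [h1, ← h3, lintegral_prod]
  · refine lintegral_congr fun s => ?_
    rw [volumeIoiPow, lintegral_withDensity_eq_lintegral_mul _ (by fun_prop)]
    · rw [← lintegral_subtype_comap measurableSet_Ioi]
      refine lintegral_congr fun r => ?_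
      simp only [Pi.mul_apply]
      rfl
    · refine hf.comp (measurable_subtype_coe.comp ?_)
      exact (homeomorphUnitSphereProd E).symm.measurable.comp (by fun_prop)
  · exact (hf.comp (measurable_subtype_coe.comp
      (homeomorphUnitSphereProd E).symm.measurable)).aemeasurable

/-- The substitution `r = √(N² + ρ²)`. -/
theorem lintegral_sqrt_add_sq (N : ℝ) (hN : 0 ≤ N) (q : ℕ) (hq : 1 ≤ q) (h : ℝ → ENNReal) :
    ∫⁻ ρ in Ioi (0 : ℝ), ENNReal.ofReal (ρ ^ (q - 1)) * h √(N ^ 2 + ρ ^ 2) =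
      ∫⁻ r in Ioi N, ENNReal.ofReal ((r ^ 2 - N ^ 2) ^ (((q : ℝ) - 2) / 2) * r) * h r := by
  have himg : (fun ρ : ℝ => √(N ^ 2 + ρ ^ 2)) '' Ioi 0 = Ioi N := by
    ext r
    simp only [mem_image, mem_Ioi]
    constructor
    · rintro ⟨ρ, hρ, rfl⟩
      exact Real.lt_sqrt_of_sq_lt (by nlinarith)
    · intro hr
      refine ⟨√(r ^ 2 - N ^ 2), Real.sqrt_pos.2 (by nlinarith), ?_⟩
      rw [Real.sq_sqrt (by nlinarith), add_sub_cancel, Real.sqrt_sq (by linarith)]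
  have hpos : ∀ ρ ∈ Ioi (0 : ℝ), 0 < N ^ 2 + ρ ^ 2 := fun ρ hρ => by
    have : 0 < ρ := hρ
    positivity
  rw [← himg, lintegral_image_eq_lintegral_abs_deriv_mul measurableSet_Ioi
    (f' := fun ρ => ρ / √(N ^ 2 + ρ ^ 2))]
  · refine setLIntegral_congr_fun measurableSet_Ioi fun ρ hρ => ?_
    have hρ0 : 0 < ρ := hρ
    have hs := Real.sqrt_pos.2 (hpos ρ hρ)
    rw [← mul_assoc, ← ENNReal.ofReal_mul (abs_nonneg _)]
    congr 2
    rw [abs_of_pos (by positivity), Real.sq_sqrt (hpos ρ hρ).le, add_sub_cancel_left,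
      ← Real.rpow_natCast ρ 2, ← Real.rpow_mul hρ0.le]
    -- The exponent $q-2$ is $-1$ for $q=1$, so it is written as the natural number $q-1$ minus a
    -- real $1$.
    have : ((2 : ℕ) : ℝ) * (((q : ℝ) - 2) / 2) = ((q - 1 : ℕ) : ℝ) - 1 := by
      push_cast [hq]; ring
    rw [this, Real.rpow_sub_one hρ0.ne', Real.rpow_natCast]
    field_simp
    rw [Real.rpow_natCast]
  · intro ρ hρ
    have := ((hasDerivAt_pow 2 ρ).const_add (N ^ 2)).sqrt (hpos ρ hρ).ne'
    refine (this.congr_deriv ?_).hasDerivWithinAt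
    field_simp
    simp
  · intro a ha b hb hab
    have ha' : 0 < a := ha
    have hb' : 0 < b := hb
    have := (Real.sqrt_inj (hpos a ha).le (hpos b hb).le).1 hab
    nlinarith

theorem lintegral_eq_lintegral_smul {P : Type*} [NormedAddCommGroup P] [NormedSpace ℝ P]
    [MeasurableSpace P] [BorelSpace P] [FiniteDimensional ℝ P] (μ : Measure P)
    [μ.IsAddHaarMeasure] (f : P → ENNReal) {r : ℝ} (hr : 0 < r) :
    ∫⁻ a, f a ∂μ = ENNReal.ofReal (r ^ Module.finrank ℝ P) * ∫⁻ a, f (r • a) ∂μ := by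
  have h := (Homeomorph.smulOfNeZero r hr.ne').toMeasurableEquiv.measurableEmbedding.lintegral_map
    f (μ := μ)
  change ∫⁻ a, f a ∂(Measure.map (r • ·) μ) = ∫⁻ a, f (r • a) ∂μ at h
  rw [← h, map_addHaar_smul μ hr.ne', lintegral_smul_measure, smul_eq_mul, ← mul_assoc,
    ← ENNReal.ofReal_mul (by positivity), abs_of_pos (by positivity),
    mul_inv_cancel₀ (by positivity)]
  simp

/-- If `ℝⁿ` is split as an orthogonal sum of `P` and `ℝ^q`, the image of the surface measure of
the sphere under the projection to `P` has the density `ω_q (1 - N²)^{(q-2)/2}` on the unit ball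
of `P`, where `N` is the norm of `P`. -/
theorem lintegral_sphere_slice {P : Type*} [NormedAddCommGroup P] [NormedSpace ℝ P]
    [MeasurableSpace P] [BorelSpace P] [FiniteDimensional ℝ P] (μ : Measure P)
    [μ.IsAddHaarMeasure] {n q : ℕ} (hq : 1 ≤ q) (hn : Module.finrank ℝ P + q = n)
    {N : P → ℝ} (hNm : Measurable N) (hN0 : ∀ a, 0 ≤ N a)
    (hNs : ∀ (r : ℝ) a, 0 < r → N (r • a) = r * N a)
    {Ψ : P × Euc q → Euc n} (hΨ : MeasurePreserving Ψ (μ.prod volume) volume)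
    {pr : Euc n → P} (hpm : Measurable pr) (hpr : ∀ a b, pr (Ψ (a, b)) = a)
    (hprs : ∀ (r : ℝ) x, pr (r • x) = r • pr x)
    (hΨn : ∀ a b, ‖Ψ (a, b)‖ ^ 2 = N a ^ 2 + ‖b‖ ^ 2)
    {f : P → ENNReal} (hf : Measurable f) :
    ∫⁻ y : Sph n, f (pr y) ∂sphMeasure n = sphMeasure q univ *
      ∫⁻ a in {a | N a < 1}, ENNReal.ofReal ((1 - N a ^ 2) ^ (((q : ℝ) - 2) / 2)) * f a ∂μ := by
  obtain ⟨p, hp⟩ : ∃ p, Module.finrank ℝ P = p := ⟨_, rfl⟩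
  rw [hp] at hn
  have : Nontrivial (Euc n) :=
    Module.nontrivial_of_finrank_pos (R := ℝ) (by rw [finrank_euclideanSpace_fin]; omega)
  have : Nontrivial (Euc q) :=
    Module.nontrivial_of_finrank_pos (R := ℝ) (by rw [finrank_euclideanSpace_fin]; omega)
  -- The radial mass of the unit ball. It appears on both sides of the final identity, and can be
  -- cancelled because it is neither zero nor infinite.
  set C : ENNReal := ∫⁻ r in Ioo (0 : ℝ) 1, ENNReal.ofReal (r ^ (n - 1)) with hC
  have hC0 : C ≠ 0 := by
    rw [hC]
    have hm : AEMeasurable (fun r : ℝ => ENNReal.ofReal (r ^ (n - 1)))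
      (volume.restrict (Ioo (0 : ℝ) 1)) := by fun_prop
    rw [Ne, lintegral_eq_zero_iff' hm, ae_eq_restrict_iff_indicator_ae_eq measurableSet_Ioo]
    intro h
    have h1 : Ioo (0 : ℝ) 1 ⊆ {r | ¬ (Ioo (0 : ℝ) 1).indicator
        (fun r : ℝ => ENNReal.ofReal (r ^ (n - 1))) r =
        (Ioo (0 : ℝ) 1).indicator 0 r} := by
      intro r hr
      have : 0 < r ^ (n - 1) := pow_pos hr.1 _
      simp [this, hr.1, hr.2]
    have := measure_mono_null h1 h
    simp at this
  have hCt : C ≠ ⊤ := by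
    refine ne_top_of_le_ne_top ?_ (setLIntegral_mono (g := fun _ => 1) measurable_const ?_)
    · simp
    · intro r hr
      exact ENNReal.ofReal_le_one.2 (pow_le_one₀ hr.1.le hr.2.le)
  -- The test function `g` extends $f\circ\mathrm{pr}$ from the sphere as a function homogeneous of
  -- degree 0, cut off outside the unit ball. Its integral over $\mathbb R^n$ is computed in two
  -- ways: in polar coordinates (`e1`), and along the splitting with polar coordinates in $\mathbb
  -- R^q$ only (`e2`).
  let h : P → ℝ → ENNReal := fun a r => if r < 1 then f (r⁻¹ • a) else 0
  let g : Euc n → ENNReal := fun x => h (pr x) ‖x‖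
  have hhm : Measurable (fun z : P × ℝ => h z.1 z.2) := by
    refine Measurable.ite (measurableSet_lt measurable_snd measurable_const) ?_ measurable_const
    exact hf.comp (by fun_prop)
  have hgm : Measurable g := hhm.comp (hpm.prodMk measurable_norm)
  have e1 : ∫⁻ x, g x = C * ∫⁻ y : Sph n, f (pr y) ∂sphMeasure n := by
    rw [lintegral_polar _ hgm, finrank_euclideanSpace_fin, ← lintegral_const_mul' _ _ hCt]
    refine lintegral_congr fun s => ?_
    rw [mul_comm, ← lintegral_const_mul _ (by fun_prop), ← Ioi_inter_Iio, inter_comm,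
      ← restrict_restrict measurableSet_Iio, ← lintegral_indicator measurableSet_Iio]
    refine setLIntegral_congr_fun measurableSet_Ioi fun r hr => ?_
    have hr0 : 0 < r := hr
    have hs : ‖(s : Euc n)‖ = 1 := by simp
    simp only [g, h, norm_smul, hs, mul_one, Real.norm_eq_abs, abs_of_pos hr0, hprs,
      inv_smul_smul₀ hr0.ne', indicator, mem_Iio]
    split_ifs
    · rw [mul_comm]
    · simp
  have e2 : ∫⁻ x, g x = sphMeasure q univ * ∫⁻ a, (∫⁻ r in Ioi (N a),
      ENNReal.ofReal ((r ^ 2 - N a ^ 2) ^ (((q : ℝ) - 2) / 2) * r) * h a r) ∂μ := by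
    have hm : AEMeasurable (fun z => g (Ψ z)) (μ.prod volume) :=
      (hgm.comp hΨ.measurable).aemeasurable
    rw [← hΨ.lintegral_comp hgm, lintegral_prod _ hm,
      ← lintegral_const_mul' _ _ (measure_ne_top _ _)]
    refine lintegral_congr fun a => ?_
    have hga : ∀ b, g (Ψ (a, b)) = h a √(N a ^ 2 + ‖b‖ ^ 2) := fun b => by
      simp only [g, hpr, ← hΨn, Real.sqrt_sq (norm_nonneg _)]
    simp only [hga]
    have hm' : Measurable fun b : Euc q => h a √(N a ^ 2 + ‖b‖ ^ 2) :=
      hhm.comp (by fun_prop : Measurable fun b : Euc q => (a, √(N a ^ 2 + ‖b‖ ^ 2)))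
    rw [lintegral_polar _ hm', finrank_euclideanSpace_fin, ← lintegral_sqrt_add_sq _ (hN0 a) q hq]
    rw [mul_comm, ← lintegral_const]
    refine lintegral_congr fun s => setLIntegral_congr_fun measurableSet_Ioi fun r hr => ?_
    have hr0 : 0 < r := hr
    simp [norm_smul]
  -- Exchanging the integrals puts the total radius $r$ outside, ready for the scaling of $a$ by
  -- $r$.
  have e3 : ∫⁻ a, (∫⁻ r in Ioi (N a),
      ENNReal.ofReal ((r ^ 2 - N a ^ 2) ^ (((q : ℝ) - 2) / 2) * r) * h a r) ∂μ =
      ∫⁻ r in Ioo (0 : ℝ) 1, ∫⁻ a, {a | N a < r}.indicator (fun a =>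
        ENNReal.ofReal ((r ^ 2 - N a ^ 2) ^ (((q : ℝ) - 2) / 2) * r) * f (r⁻¹ • a)) a ∂μ := by
    rw [lintegral_lintegral_swap]
    · refine lintegral_congr fun a => ?_
      rw [← lintegral_indicator measurableSet_Ioi, ← lintegral_indicator measurableSet_Ioo]
      refine lintegral_congr fun r => ?_
      by_cases h1 : N a < r
      · have : 0 < r := (hN0 a).trans_lt h1
        by_cases h2 : r < 1 <;> simp [h, indicator, h1, h2, this]
      · simp [indicator, h1]
    · refine Measurable.aemeasurable ?_
      have : Measurable (fun z : ℝ × P => {z : ℝ × P | N z.2 < z.1}.indicator (fun z =>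
        ENNReal.ofReal ((z.1 ^ 2 - N z.2 ^ 2) ^ (((q : ℝ) - 2) / 2) * z.1) * f (z.1⁻¹ • z.2)) z) := by
        refine Measurable.indicator ?_ (measurableSet_lt (by fun_prop) (by fun_prop))
        exact Measurable.mul (by fun_prop) (hf.comp (by fun_prop))
      exact this
  -- Scaling $a$ by $r$ collects $r^{p}\cdot r^{q-2}\cdot r = r^{n-1}$, the integrand of `C`.
  have e4 : ∀ r ∈ Ioo (0 : ℝ) 1, ∫⁻ a, {a | N a < r}.indicator (fun a =>
        ENNReal.ofReal ((r ^ 2 - N a ^ 2) ^ (((q : ℝ) - 2) / 2) * r) * f (r⁻¹ • a)) a ∂μ =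
      ENNReal.ofReal (r ^ (n - 1)) * ∫⁻ a in {a | N a < 1},
        ENNReal.ofReal ((1 - N a ^ 2) ^ (((q : ℝ) - 2) / 2)) * f a ∂μ := by
    intro r hr
    have hr0 : 0 < r := hr.1
    rw [lintegral_eq_lintegral_smul μ _ hr0, hp, ← lintegral_indicator
      (measurableSet_lt hNm measurable_const), ← lintegral_const_mul' _ _ ENNReal.ofReal_ne_top,
      ← lintegral_const_mul' _ _ ENNReal.ofReal_ne_top]
    refine lintegral_congr fun a => ?_
    by_cases h1 : N a < 1
    · have h2 : r • a ∈ {a | N a < r} := by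
        rw [mem_ofPred_eq, hNs r a hr0]; nlinarith
      rw [indicator_of_mem h2, indicator_of_mem (by exact h1), inv_smul_smul₀ hr0.ne', ← mul_assoc,
        ← mul_assoc, ← ENNReal.ofReal_mul (by positivity), ← ENNReal.ofReal_mul (by positivity)]
      congr 2
      have h3 : r ^ 2 - N (r • a) ^ 2 = r ^ 2 * (1 - N a ^ 2) := by rw [hNs r a hr0]; ring
      have h4 : 0 ≤ 1 - N a ^ 2 := by nlinarith [hN0 a]
      rw [h3, Real.mul_rpow (by positivity) h4, ← Real.rpow_natCast r 2, ← Real.rpow_mul hr0.le]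
      have h5 : ((2 : ℕ) : ℝ) * (((q : ℝ) - 2) / 2) = ((q - 1 : ℕ) : ℝ) - 1 := by
        push_cast [hq]; ring
      rw [h5, Real.rpow_sub_one hr0.ne', Real.rpow_natCast, show n - 1 = p + (q - 1) by omega,
        pow_add]
      field_simp
    · have h2 : r • a ∉ {a | N a < r} := by
        rw [mem_ofPred_eq, hNs r a hr0]; nlinarith
      rw [indicator_of_notMem h2, indicator_of_notMem (by exact h1)]
      simp
  have e5 := e1.symm.trans e2
  rw [e3, setLIntegral_congr_fun measurableSet_Ioo e4, lintegral_mul_const _ (by fun_prop), ← hC,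
    mul_left_comm] at e5
  exact (ENNReal.mul_right_inj hC0 hCt).1 e5

end Slicing

/-! ### Rotation invariance of the surface measure. -/

section Rotation

open Set
open scoped Pointwise

theorem norm_coe_sph {n : ℕ} (x : Sph n) : ‖(x : Euc n)‖ = 1 := by simp

theorem continuous_rot {n : ℕ} (g : Euc n ≃ₗᵢ[ℝ] Euc n) : Continuous (rot g) :=
  Continuous.subtype_mk (by fun_prop) _

/-- The surface measure of a set is a multiple of the volume of the cone over it, and an isometry
carries cones to cones and preserves volume. -/
theorem measurePreserving_rot {n : ℕ} (g : Euc n ≃ₗᵢ[ℝ] Euc n) :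
    MeasurePreserving (rot g) (sphMeasure n) (sphMeasure n) := by
  refine ⟨(continuous_rot g).measurable, ?_⟩
  ext s hs
  rw [Measure.map_apply (continuous_rot g).measurable hs]
  unfold sphMeasure
  rw [Measure.toSphere_apply' _ hs,
    Measure.toSphere_apply' _ ((continuous_rot g).measurable hs)]
  congr 1
  rw [← g.measurePreserving.measure_preimage_equiv (f := g.toMeasurableEquiv)
    (Ioo (0 : ℝ) 1 • (Subtype.val '' s))]
  congr 1
  ext x
  simp only [mem_smul, mem_preimage, mem_image]
  constructor
  · rintro ⟨r, hr, _, ⟨y, hy, rfl⟩, rfl⟩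
    exact ⟨r, hr, _, ⟨rot g y, hy, rfl⟩, by simp [rot]⟩
  · rintro ⟨r, hr, _, ⟨y, hy, rfl⟩, hx⟩
    refine ⟨r, hr, _, ⟨rot g.symm y, ?_, rfl⟩, ?_⟩
    · have : rot g (rot g.symm y) = y := by ext1; simp [rot]
      simpa [this] using hy
    · have : g.symm (g x) = g.symm (r • (y : Euc n)) := by rw [hx]; rfl
      simpa [rot] using this.symm

end Rotation

/-! ### The law of one and of two orthogonal coordinates on the sphere. -/

section OrthogonalSplitting

/-- Prepending a coordinate. -/
def consEuc (m : ℕ) (z : ℝ × Euc m) : Euc (m + 1) :=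
  WithLp.toLp 2 (Fin.cons z.1 z.2)

@[simp] theorem consEuc_zero {m : ℕ} (z : ℝ × Euc m) : consEuc m z 0 = z.1 := rfl

@[simp] theorem consEuc_succ {m : ℕ} (z : ℝ × Euc m) (i : Fin m) :
    consEuc m z i.succ = z.2 i := rfl

theorem norm_consEuc_sq {m : ℕ} (a : ℝ) (b : Euc m) :
    ‖consEuc m (a, b)‖ ^ 2 = a ^ 2 + ‖b‖ ^ 2 := by
  simp [EuclideanSpace.norm_sq_eq, Fin.sum_univ_succ]

theorem measurePreserving_consEuc (m : ℕ) :
    MeasurePreserving (consEuc m) (volume.prod volume) volume := by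
  have h1 := (volume_preserving_piFinSuccAbove (fun _ : Fin (m + 1) => ℝ) 0).symm
  have h2 := PiLp.volume_preserving_toLp (Fin (m + 1))
  have h3 := (MeasurePreserving.id (volume : Measure ℝ)).prod (PiLp.volume_preserving_ofLp (Fin m))
  convert! h2.comp (h1.comp h3) using 1
  funext z
  simp only [consEuc, Function.comp]
  congr 1
  simp [MeasurableEquiv.piFinSuccAbove, Fin.insertNthEquiv]

open Set Measure

/-- The distribution of one coordinate of a point of the sphere. -/
theorem lintegral_sphere_inner {n : ℕ} (hn : 2 ≤ n) {e : Euc n} (he : ‖e‖ = 1)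
    {f : ℝ → ENNReal} (hf : Measurable f) :
    ∫⁻ y : Sph n, f ⟪e, (y : Euc n)⟫ ∂sphMeasure n = sphMeasure (n - 1) univ *
      ∫⁻ u in {u | |u| < 1},
        ENNReal.ofReal ((1 - u ^ 2) ^ ((((n - 1 : ℕ) : ℝ) - 2) / 2)) * f u := by
  obtain ⟨m, rfl⟩ : ∃ m, n = m + 1 := ⟨n - 1, by omega⟩
  have ho : Orthonormal ℝ (({0} : Set (Fin (m + 1))).domRestrict fun _ => e) := by
    rw [orthonormal_iff_ite]
    rintro ⟨i, hi⟩ ⟨j, hj⟩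
    simp only [mem_singleton_iff] at hi hj
    subst hi hj
    simp [he]
  obtain ⟨b, hb⟩ := ho.exists_orthonormalBasis_extension_of_card_eq (by simp)
  have hb0 : b 0 = e := hb 0 rfl
  have h := lintegral_sphere_slice (volume : Measure ℝ) (n := m + 1) (q := m) (by omega)
    (by simp [add_comm]) (N := fun a => |a|) (by fun_prop) (fun a => abs_nonneg a)
    (fun r a hr => by simp [abs_mul, abs_of_pos hr])
    (Ψ := fun z => b.repr.symm (consEuc m z))
    (b.measurePreserving_repr_symm.comp (measurePreserving_consEuc m))
    (pr := fun x => ⟪e, x⟫) (by fun_prop)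
    (fun a z => by rw [← hb0, ← b.repr_apply_apply]; simp)
    (fun r x => by simp [inner_smul_right])
    (fun a z => by simp [norm_consEuc_sq]) hf
  simp only [sq_abs] at h
  exact h

/-- The distribution of two coordinates of a point of the sphere. -/
theorem lintegral_sphere_inner_pair {n : ℕ} (hn : 3 ≤ n) {e e' : Euc n} (he : ‖e‖ = 1)
    (he' : ‖e'‖ = 1) (hee : ⟪e, e'⟫ = 0) {f : ℝ × ℝ → ENNReal} (hf : Measurable f) :
    ∫⁻ y : Sph n, f (⟪e, (y : Euc n)⟫, ⟪e', (y : Euc n)⟫) ∂sphMeasure n =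
      sphMeasure (n - 2) univ * ∫⁻ a in {a : ℝ × ℝ | a.1 ^ 2 + a.2 ^ 2 < 1},
        ENNReal.ofReal ((1 - (a.1 ^ 2 + a.2 ^ 2)) ^ (((n : ℝ) - 4) / 2)) * f a := by
  obtain ⟨m, rfl⟩ : ∃ m, n = m + 2 := ⟨n - 2, by omega⟩
  have ho : Orthonormal ℝ (({0, 1} : Set (Fin (m + 2))).domRestrict
      fun i => if i = 0 then e else e') := by
    rw [orthonormal_iff_ite]
    rintro ⟨i, hi⟩ ⟨j, hj⟩
    simp only [mem_insert_iff, mem_singleton_iff] at hi hj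
    have hee' : ⟪e', e⟫ = 0 := by rw [real_inner_comm, hee]
    rcases hi with rfl | rfl <;> rcases hj with rfl | rfl <;> simp [he, he', hee, hee']
  obtain ⟨b, hb⟩ := ho.exists_orthonormalBasis_extension_of_card_eq (by simp)
  have hb0 : b 0 = e := hb 0 (by simp)
  have hb1 : b 1 = e' := hb 1 (by simp)
  have hΨ : MeasurePreserving
      (fun z : (ℝ × ℝ) × Euc m => b.repr.symm (consEuc (m + 1) (z.1.1, consEuc m (z.1.2, z.2))))
      (volume.prod volume) volume := by
    have h1 := (MeasurePreserving.id (volume : Measure ℝ)).prod (measurePreserving_consEuc m)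
    have h2 : MeasurePreserving (MeasurableEquiv.prodAssoc : (ℝ × ℝ) × Euc m ≃ᵐ ℝ × ℝ × Euc m)
      (volume.prod volume) (volume.prod (volume.prod volume)) := volume_preserving_prodAssoc
    exact b.measurePreserving_repr_symm.comp ((measurePreserving_consEuc (m + 1)).comp (h1.comp h2))
  have h := lintegral_sphere_slice (volume : Measure (ℝ × ℝ)) (n := m + 2) (q := m) (by omega)
    (by simp [add_comm]) (N := fun a => √(a.1 ^ 2 + a.2 ^ 2)) (by fun_prop)
    (fun a => Real.sqrt_nonneg _)
    (fun r a hr => by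
      have : (r • a).1 ^ 2 + (r • a).2 ^ 2 = r ^ 2 * (a.1 ^ 2 + a.2 ^ 2) := by simp; ring
      rw [this, Real.sqrt_mul (by positivity), Real.sqrt_sq hr.le])
    hΨ
    (pr := fun x => (⟪e, x⟫, ⟪e', x⟫)) (by fun_prop)
    (fun a z => by
      rw [← hb0, ← hb1, ← b.repr_apply_apply, ← b.repr_apply_apply]
      simp only [LinearIsometryEquiv.apply_symm_apply, consEuc_zero]
      rw [← Fin.succ_zero_eq_one, consEuc_succ, consEuc_zero])
    (fun r x => by simp [inner_smul_right])
    (fun a z => by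
      simp only [LinearIsometryEquiv.norm_map, norm_consEuc_sq]
      rw [Real.sq_sqrt (by positivity)]; ring) hf
  have hs : {a : ℝ × ℝ | √(a.1 ^ 2 + a.2 ^ 2) < 1} = {a | a.1 ^ 2 + a.2 ^ 2 < 1} := by
    ext a
    simp [Real.sqrt_lt' one_pos]
  rw [hs] at h
  have hexp : (((m + 2 : ℕ) : ℝ) - 4) / 2 = ((m : ℝ) - 2) / 2 := by push_cast; ring
  rw [hexp]
  refine h.trans ?_
  congr 1
  refine lintegral_congr fun a => ?_
  rw [Real.sq_sqrt (by positivity)]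

end OrthogonalSplitting

/-! ### The law of $(e\cdot x, e\cdot y, x\cdot y)$ and the scalar product $[F,G]$. -/

section DoubleIntegral

open Set Measure

/-- The Gram determinant `1 - u² - v² - t² + 2uvt`. -/
def gramDet (u v t : ℝ) : ℝ := 1 - u ^ 2 - v ^ 2 - t ^ 2 + 2 * u * v * t

theorem gramDet_eq (u v t : ℝ) :
    gramDet u v t = (1 - u ^ 2) * (1 - v ^ 2) - (t - u * v) ^ 2 := by
  unfold gramDet; ring

/-- The integrand `D^{(n-4)/2} f` on the region where the Gram determinant `D` is positive. -/
def gramIntegrand (n : ℕ) (f : ℝ × ℝ × ℝ → ENNReal) (u v t : ℝ) : ENNReal :=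
  {w : ℝ × ℝ × ℝ | 0 < gramDet w.1 w.2.1 w.2.2}.indicator
    (fun w => ENNReal.ofReal (gramDet w.1 w.2.1 w.2.2 ^ (((n : ℝ) - 4) / 2)) * f w) (u, v, t)

theorem measurable_gramIntegrand (n : ℕ) {f : ℝ × ℝ × ℝ → ENNReal} (hf : Measurable f) :
    Measurable fun w : ℝ × ℝ × ℝ => gramIntegrand n f w.1 w.2.1 w.2.2 := by
  have h : Measurable fun w : ℝ × ℝ × ℝ => gramDet w.1 w.2.1 w.2.2 := by
    unfold gramDet; fun_prop
  refine Measurable.indicator ?_ (measurableSet_lt measurable_const h)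
  exact (h.pow_const _).ennreal_ofReal.mul hf

/-- The equation is quadratic in $t$, so it has at most two roots. Hence the closed region `Omega`
may be exchanged for the open one where the determinant is positive. -/
theorem gramDet_ne_zero_ae (u v : ℝ) : ∀ᵐ t : ℝ, gramDet u v t ≠ 0 := by
  have hsub : {t : ℝ | gramDet u v t = 0} ⊆
      {u * v + √((1 - u ^ 2) * (1 - v ^ 2)), u * v - √((1 - u ^ 2) * (1 - v ^ 2))} := by
    intro t ht
    have h1 : (t - u * v) ^ 2 = (1 - u ^ 2) * (1 - v ^ 2) := by
      have : gramDet u v t = 0 := ht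
      rw [gramDet_eq] at this
      linarith
    have h2 : (t - u * v) ^ 2 = √((1 - u ^ 2) * (1 - v ^ 2)) ^ 2 := by
      rw [Real.sq_sqrt (h1 ▸ sq_nonneg _), h1]
    rcases sq_eq_sq_iff_eq_or_eq_neg.1 h2 with h | h
    · left; linarith
    · right; rw [mem_singleton_iff]; linarith
  have hz : volume {t : ℝ | gramDet u v t = 0} = 0 :=
    measure_mono_null hsub (((finite_singleton _).insert _).measure_zero _)
  rw [ae_iff]
  simpa using hz

/-- Integration over one sphere with the other variable fixed. -/
theorem lintegral_sphere_fixed {n : ℕ} (hn : 3 ≤ n) {e : Euc n} (he : ‖e‖ = 1) (x : Sph n)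
    (hx : |⟪e, (x : Euc n)⟫| < 1) {f : ℝ × ℝ × ℝ → ENNReal} (hf : Measurable f) :
    ENNReal.ofReal (√(1 - ⟪e, (x : Euc n)⟫ ^ 2) ^ (n - 3)) *
      ∫⁻ y : Sph n, f (⟪e, (x : Euc n)⟫, ⟪e, (y : Euc n)⟫, ⟪(x : Euc n), (y : Euc n)⟫)
        ∂sphMeasure n =
    sphMeasure (n - 2) univ * ∫⁻ v, ∫⁻ t, gramIntegrand n f ⟪e, (x : Euc n)⟫ v t := by
  obtain ⟨u, hu⟩ : ∃ u, ⟪e, (x : Euc n)⟫ = u := ⟨_, rfl⟩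
  rw [hu] at hx ⊢
  have hu1 : 0 < 1 - u ^ 2 := by
    have := (sq_lt_one_iff_abs_lt_one u).2 hx; linarith
  set c := √(1 - u ^ 2) with hc
  have hc0 : 0 < c := Real.sqrt_pos.2 hu1
  have hc2 : c ^ 2 = 1 - u ^ 2 := Real.sq_sqrt hu1.le
  set e' : Euc n := c⁻¹ • ((x : Euc n) - u • e) with he'
  have hx1 : ‖(x : Euc n)‖ = 1 := norm_coe_sph x
  have hee : ⟪e, e'⟫ = 0 := by
    rw [he', inner_smul_right, inner_sub_right, inner_smul_right, hu, real_inner_self_eq_norm_sq,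
      he]
    ring
  have hxe : (x : Euc n) = u • e + c • e' := by
    rw [he', smul_inv_smul₀ hc0.ne']; abel
  have he'1 : ‖e'‖ = 1 := by
    have h1 : ‖(x : Euc n) - u • e‖ ^ 2 = c ^ 2 := by
      rw [norm_sub_sq_real, inner_smul_right, real_inner_comm, hu, norm_smul, mul_pow, he, hx1,
        Real.norm_eq_abs, sq_abs, hc2]
      ring
    have h2 : ‖(x : Euc n) - u • e‖ = c := by
      rwa [sq_eq_sq₀ (norm_nonneg _) hc0.le] at h1
    rw [he', norm_smul, norm_inv, Real.norm_eq_abs, abs_of_pos hc0, h2, inv_mul_cancel₀ hc0.ne']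
  have hinner : ∀ y : Euc n, ⟪(x : Euc n), y⟫ = u * ⟪e, y⟫ + c * ⟪e', y⟫ := fun y => by
    conv_lhs => rw [hxe]
    rw [inner_add_left, real_inner_smul_left, real_inner_smul_left]
  simp only [hinner]
  rw [lintegral_sphere_inner_pair hn he he'1 hee
    (f := fun a => f (u, a.1, u * a.1 + c * a.2)) (hf.comp (by fun_prop)), mul_left_comm]
  congr 1
  have hset : MeasurableSet {a : ℝ × ℝ | a.1 ^ 2 + a.2 ^ 2 < 1} :=
    measurableSet_lt (by fun_prop) measurable_const
  rw [← lintegral_indicator hset, volume_eq_prod, lintegral_prod,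
    ← lintegral_const_mul' _ _ ENNReal.ofReal_ne_top]
  · refine lintegral_congr fun v => ?_
    -- The substitution $t = uv + cb$, as a translation followed by a dilation.
    rw [← lintegral_add_left_eq_self (fun t => gramIntegrand n f u v t) (u * v),
      lintegral_eq_lintegral_smul volume (fun t => gramIntegrand n f u v (u * v + t)) hc0, ← lintegral_const_mul' _ _ ENNReal.ofReal_ne_top,
      ← lintegral_const_mul' _ _ ENNReal.ofReal_ne_top]
    refine lintegral_congr fun b => ?_
    have hD : gramDet u v (u * v + c • b) = c ^ 2 * (1 - (v ^ 2 + b ^ 2)) := by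
      rw [gramDet_eq, ← hc2, smul_eq_mul]; ring
    unfold gramIntegrand
    by_cases hb : v ^ 2 + b ^ 2 < 1
    · have hb' : 0 < 1 - (v ^ 2 + b ^ 2) := by linarith
      rw [indicator_of_mem (by exact hb), indicator_of_mem]
      · simp only [hD, ← mul_assoc]
        rw [← ENNReal.ofReal_mul (by positivity), ← ENNReal.ofReal_mul (by positivity)]
        congr 2
        rw [Real.mul_rpow (by positivity) hb'.le, ← Real.rpow_natCast c 2, ← Real.rpow_mul hc0.le]
        -- The determinant contributes $c^{n-4}$ and the dilation $c$, which together give the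
        -- factor $c^{n-3}$ of the statement.
        have h5 : ((2 : ℕ) : ℝ) * (((n : ℝ) - 4) / 2) = ((n - 3 : ℕ) : ℝ) - 1 := by
          push_cast [hn]; ring
        rw [h5, Real.rpow_sub_one hc0.ne', Real.rpow_natCast]
        simp only [Module.finrank_self, pow_one]
        field_simp
      · rw [mem_ofPred_eq, hD]
        positivity
    · rw [indicator_of_notMem (by exact hb), indicator_of_notMem]
      · simp
      · rw [mem_ofPred_eq, hD, not_lt]
        exact mul_nonpos_of_nonneg_of_nonpos (by positivity) (by linarith)
  · refine (Measurable.indicator ?_ hset).aemeasurable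
    exact Measurable.mul (by fun_prop) (hf.comp (by fun_prop))

theorem measurableSet_Omega : MeasurableSet Omega := by
  have h : MeasurableSet (Icc (-1 : ℝ) 1) := measurableSet_Icc
  have h1 : MeasurableSet {w : ℝ × ℝ × ℝ | w.1 ∈ Icc (-1 : ℝ) 1} := h.preimage (by fun_prop)
  have h2 : MeasurableSet {w : ℝ × ℝ × ℝ | w.2.1 ∈ Icc (-1 : ℝ) 1} := h.preimage (by fun_prop)
  have h3 : MeasurableSet {w : ℝ × ℝ × ℝ | w.2.2 ∈ Icc (-1 : ℝ) 1} := h.preimage (by fun_prop)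
  have h4 : MeasurableSet {w : ℝ × ℝ × ℝ |
      0 ≤ 1 + 2 * w.1 * w.2.1 * w.2.2 - w.1 ^ 2 - w.2.1 ^ 2 - w.2.2 ^ 2} :=
    measurableSet_le measurable_const (by fun_prop)
  exact h1.inter (h2.inter (h3.inter h4))

/-- The bounds on $v$ and $t$ are automatic: a positive determinant forces $(1-u^2)(1-v^2) > 0$, and
likewise with $t$ in place of $v$ by symmetry. -/
theorem mem_Omega_iff {u v t : ℝ} (hu : |u| < 1) (hD : gramDet u v t ≠ 0) :
    (u, v, t) ∈ Omega ↔ 0 < gramDet u v t := by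
  have hu1 := (sq_lt_one_iff_abs_lt_one u).2 hu
  constructor
  · rintro ⟨-, -, -, h⟩
    refine lt_of_le_of_ne ?_ hD.symm
    dsimp only at h
    unfold gramDet
    linarith
  · intro h
    have hv : v ^ 2 < 1 := by
      by_contra hv
      rw [gramDet_eq] at h
      nlinarith [sq_nonneg (t - u * v)]
    have ht : t ^ 2 < 1 := by
      by_contra ht
      have : gramDet u v t = (1 - u ^ 2) * (1 - t ^ 2) - (v - u * t) ^ 2 := by
        unfold gramDet; ring
      rw [this] at h
      nlinarith [sq_nonneg (v - u * t)]
    refine ⟨abs_le.1 hu.le, abs_le.1 ((sq_lt_one_iff_abs_lt_one v).1 hv).le,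
      abs_le.1 ((sq_lt_one_iff_abs_lt_one t).1 ht).le, ?_⟩
    unfold gramDet at h
    dsimp only
    linarith

theorem lintegral_gramIntegrand (n : ℕ) {f : ℝ × ℝ × ℝ → ENNReal} (hf : Measurable f) :
    ∫⁻ u in {u : ℝ | |u| < 1}, ∫⁻ v, ∫⁻ t, gramIntegrand n f u v t =
      ∫⁻ w in Omega, ENNReal.ofReal (gramDet w.1 w.2.1 w.2.2 ^ (((n : ℝ) - 4) / 2)) * f w := by
  have hD : Measurable fun w : ℝ × ℝ × ℝ => gramDet w.1 w.2.1 w.2.2 := by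
    unfold gramDet; fun_prop
  have hm : Measurable (Omega.indicator fun w : ℝ × ℝ × ℝ =>
      ENNReal.ofReal (gramDet w.1 w.2.1 w.2.2 ^ (((n : ℝ) - 4) / 2)) * f w) :=
    ((hD.pow_const _).ennreal_ofReal.mul hf).indicator measurableSet_Omega
  have habs : MeasurableSet {u : ℝ | |u| < 1} := measurableSet_lt (by fun_prop) measurable_const
  rw [← lintegral_indicator measurableSet_Omega, volume_eq_prod, lintegral_prod _ hm.aemeasurable,
    ← lintegral_indicator habs]
  have hne : ∀ᵐ u : ℝ, |u| ≠ 1 := by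
    rw [ae_iff]
    refine measure_mono_null (t := {1, -1}) ?_ (((finite_singleton _).insert _).measure_zero _)
    intro u hu
    simp only [ne_eq, not_not, mem_ofPred_eq] at hu
    exact (abs_eq one_pos.le).1 hu
  refine lintegral_congr_ae (hne.mono fun u hu => ?_)
  dsimp only
  have hmu : AEMeasurable (fun z : ℝ × ℝ => Omega.indicator (fun w : ℝ × ℝ × ℝ =>
      ENNReal.ofReal (gramDet w.1 w.2.1 w.2.2 ^ (((n : ℝ) - 4) / 2)) * f w) (u, z))
      (volume.prod volume) :=
    (hm.comp measurable_prodMk_left).aemeasurable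
  rw [volume_eq_prod, lintegral_prod _ hmu]
  by_cases h1 : |u| < 1
  · rw [indicator_of_mem (by exact h1)]
    refine lintegral_congr fun v => lintegral_congr_ae ((gramDet_ne_zero_ae u v).mono fun t ht => ?_)
    simp only [gramIntegrand, indicator, mem_Omega_iff h1 ht, mem_ofPred_eq]
  · have h2 : ∀ v t, (u, v, t) ∉ Omega := fun v t h =>
      h1 (lt_of_le_of_ne (abs_le.2 h.1) hu)
    rw [indicator_of_notMem (by exact h1)]
    simp [indicator, h2]

/-- The double integral over the sphere of a function of `(e·x, e·y, x·y)`. -/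
theorem lintegral_lintegral_sphere {n : ℕ} (hn : 3 ≤ n) {e : Euc n} (he : ‖e‖ = 1)
    {f : ℝ × ℝ × ℝ → ENNReal} (hf : Measurable f) :
    ∫⁻ x : Sph n, (∫⁻ y : Sph n,
      f (⟪e, (x : Euc n)⟫, ⟪e, (y : Euc n)⟫, ⟪(x : Euc n), (y : Euc n)⟫) ∂sphMeasure n)
        ∂sphMeasure n =
    sphMeasure (n - 1) univ * (sphMeasure (n - 2) univ *
      ∫⁻ w in Omega, ENNReal.ofReal (gramDet w.1 w.2.1 w.2.2 ^ (((n : ℝ) - 4) / 2)) * f w) := by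
  let J : ℝ → ENNReal := fun u => ∫⁻ v, ∫⁻ t, gramIntegrand n f u v t
  have hJ : Measurable J := by
    have h := (measurable_gramIntegrand n hf).comp
      (by fun_prop : Measurable fun z : (ℝ × ℝ) × ℝ => (z.1.1, z.1.2, z.2))
    exact h.lintegral_prod_right'.lintegral_prod_right'
  -- The law of $e\cdot x$, applied to the indicator of the complement of $(-1,1)$, shows that the
  -- poles $\pm e$ are negligible.
  have hlt : ∀ᵐ x : Sph n ∂sphMeasure n, |⟪e, (x : Euc n)⟫| < 1 := by
    have habs : MeasurableSet {u : ℝ | |u| < 1}ᶜ :=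
      (measurableSet_lt (by fun_prop) measurable_const).compl
    have h := lintegral_sphere_inner (by omega : 2 ≤ n) he
      (f := ({u : ℝ | |u| < 1}ᶜ).indicator 1) (measurable_one.indicator habs)
    have h0 : ∫⁻ u in {u : ℝ | |u| < 1}, ENNReal.ofReal ((1 - u ^ 2) ^
        ((((n - 1 : ℕ) : ℝ) - 2) / 2)) * ({u : ℝ | |u| < 1}ᶜ).indicator 1 u = 0 := by
      rw [setLIntegral_congr_fun (g := fun _ => 0)
        (measurableSet_lt (by fun_prop) measurable_const)]
      · simp
      · intro u hu
        simp only [mem_ofPred_eq] at hu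
        simp [hu]
    have hm : Measurable fun x : Sph n =>
        ({u : ℝ | |u| < 1}ᶜ).indicator (1 : ℝ → ENNReal) ⟪e, (x : Euc n)⟫ :=
      (measurable_one.indicator habs).comp (by fun_prop)
    rw [h0, mul_zero, lintegral_eq_zero_iff hm] at h
    refine h.mono fun x hx => ?_
    by_contra hc
    simp [indicator, hc] at hx
  have h1 : ∀ᵐ x : Sph n ∂sphMeasure n, ∫⁻ y : Sph n,
      f (⟪e, (x : Euc n)⟫, ⟪e, (y : Euc n)⟫, ⟪(x : Euc n), (y : Euc n)⟫) ∂sphMeasure n =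
      (ENNReal.ofReal (√(1 - ⟪e, (x : Euc n)⟫ ^ 2) ^ (n - 3)))⁻¹ *
        (sphMeasure (n - 2) univ * J ⟪e, (x : Euc n)⟫) := by
    refine hlt.mono fun x hx => ?_
    have hu1 : 0 < 1 - ⟪e, (x : Euc n)⟫ ^ 2 := by
      have := (sq_lt_one_iff_abs_lt_one _).2 hx; linarith
    have h2 : ENNReal.ofReal (√(1 - ⟪e, (x : Euc n)⟫ ^ 2) ^ (n - 3)) ≠ 0 := by
      have : 0 < √(1 - ⟪e, (x : Euc n)⟫ ^ 2) ^ (n - 3) := pow_pos (Real.sqrt_pos.2 hu1) _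
      exact (ENNReal.ofReal_pos.2 this).ne'
    rw [← lintegral_sphere_fixed hn he x hx hf, ← mul_assoc,
      ENNReal.inv_mul_cancel h2 ENNReal.ofReal_ne_top, one_mul]
  rw [lintegral_congr_ae h1, lintegral_sphere_inner (by omega : 2 ≤ n) he (f := fun u =>
    (ENNReal.ofReal (√(1 - u ^ 2) ^ (n - 3)))⁻¹ * (sphMeasure (n - 2) univ * J u))
    (by fun_prop)]
  congr 1
  rw [← lintegral_gramIntegrand n hf, ← lintegral_const_mul' _ _ (measure_ne_top _ _)]
  refine setLIntegral_congr_fun (measurableSet_lt (by fun_prop) measurable_const) fun u hu => ?_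
  have hu1 : 0 < 1 - u ^ 2 := by
    have := (sq_lt_one_iff_abs_lt_one u).2 hu; linarith
  have hs := Real.sqrt_pos.2 hu1
  -- The density of the first coordinate is exactly the factor $c^{n-3}$ left by the inner integral,
  -- so the two cancel.
  have h3 : (1 - u ^ 2) ^ ((((n - 1 : ℕ) : ℝ) - 2) / 2) = √(1 - u ^ 2) ^ (n - 3) := by
    rw [Real.sqrt_eq_rpow, ← Real.rpow_natCast _ (n - 3), ← Real.rpow_mul hu1.le]
    congr 1
    push_cast [hn, (by omega : 1 ≤ n)]
    ring
  have h4 : ENNReal.ofReal (√(1 - u ^ 2) ^ (n - 3)) ≠ 0 := by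
    have : 0 < √(1 - u ^ 2) ^ (n - 3) := pow_pos hs _
    exact (ENNReal.ofReal_pos.2 this).ne'
  rw [h3, ← mul_assoc, ENNReal.mul_inv_cancel h4 ENNReal.ofReal_ne_top, one_mul]

/-- The map `(x, y) ↦ (e·x, e·y, x·y)`. -/
def innerTriple {n : ℕ} (e : Euc n) (z : Sph n × Sph n) : ℝ × ℝ × ℝ :=
  (⟪e, (z.1 : Euc n)⟫, ⟪e, (z.2 : Euc n)⟫, ⟪(z.1 : Euc n), (z.2 : Euc n)⟫)

theorem continuous_innerTriple {n : ℕ} (e : Euc n) : Continuous (innerTriple e) := by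
  unfold innerTriple; fun_prop

theorem measurable_weight (n : ℕ) : Measurable (weight n) := by
  unfold weight; fun_prop

theorem weight_nonneg {n : ℕ} {w : ℝ × ℝ × ℝ} (hw : w ∈ Omega) : 0 ≤ weight n w := by
  have h : ∀ m, 0 ≤ omega m := fun m => measureReal_nonneg
  have h1 := hw.2.2.2
  exact mul_nonneg (div_nonneg (mul_nonneg (h _) (h _)) (sq_nonneg _))
    (Real.rpow_nonneg (by linarith) _)

theorem map_innerTriple {n : ℕ} (hn : 3 ≤ n) {e : Euc n} (he : ‖e‖ = 1) :
    (volume.restrict Omega).withDensity (fun w => ENNReal.ofReal (weight n w)) =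
      ENNReal.ofReal (1 / omega n ^ 2) •
        Measure.map (innerTriple e) ((sphMeasure n).prod (sphMeasure n)) := by
  have hm := (continuous_innerTriple e).measurable
  have hω : ∀ m, sphMeasure m univ = ENNReal.ofReal (omega m) := fun m =>
    (ofReal_measureReal (measure_ne_top _ _)).symm
  have hω0 : ∀ m, 0 ≤ omega m := fun m => measureReal_nonneg
  ext s hs
  have h1 := lintegral_lintegral_sphere hn he (f := s.indicator 1) (measurable_one.indicator hs)
  have hg : Measurable fun z => s.indicator (1 : ℝ × ℝ × ℝ → ENNReal) (innerTriple e z) :=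
    (measurable_one.indicator hs).comp hm
  have h2 : Measure.map (innerTriple e) ((sphMeasure n).prod (sphMeasure n)) s =
      ∫⁻ x : Sph n, (∫⁻ y : Sph n, s.indicator (1 : ℝ × ℝ × ℝ → ENNReal)
        (⟪e, (x : Euc n)⟫, ⟪e, (y : Euc n)⟫, ⟪(x : Euc n), (y : Euc n)⟫) ∂sphMeasure n)
          ∂sphMeasure n := by
    rw [← lintegral_indicator_one hs, lintegral_map (measurable_one.indicator hs) hm,
      lintegral_prod _ hg.aemeasurable]
    rfl
  rw [Measure.smul_apply, smul_eq_mul, h2, h1, withDensity_apply _ hs, hω, hω, ← mul_assoc, ← mul_assoc,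
    ← ENNReal.ofReal_mul (by positivity),
    ← ENNReal.ofReal_mul (mul_nonneg (by positivity) (hω0 _)),
    ← lintegral_const_mul' _ _ ENNReal.ofReal_ne_top,
    ← lintegral_indicator hs]
  refine setLIntegral_congr_fun measurableSet_Omega fun w hw => ?_
  by_cases hws : w ∈ s
  · simp only [indicator_of_mem hws, Pi.one_apply, mul_one]
    rw [← ENNReal.ofReal_mul (mul_nonneg (mul_nonneg (by positivity) (hω0 _)) (hω0 _))]
    congr 1
    unfold weight gramDet
    ring
  · simp [indicator_of_notMem hws]

/-- The scalar product of two polynomials in terms of a double integral over the sphere. -/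
theorem polyInner_eq_integral {n : ℕ} (hn : 3 ≤ n) {e : Euc n} (he : ‖e‖ = 1) (F G : Poly3) :
    polyInner n F G = 1 / omega n ^ 2 * ∫ z : Sph n × Sph n,
      MvPolynomial.eval ![⟪e, (z.1 : Euc n)⟫, ⟪e, (z.2 : Euc n)⟫, ⟪(z.1 : Euc n), (z.2 : Euc n)⟫] F *
      MvPolynomial.eval ![⟪e, (z.1 : Euc n)⟫, ⟪e, (z.2 : Euc n)⟫, ⟪(z.1 : Euc n), (z.2 : Euc n)⟫] G
      ∂((sphMeasure n).prod (sphMeasure n)) := by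
  let Φ : ℝ × ℝ × ℝ → ℝ := fun w =>
    MvPolynomial.eval ![w.1, w.2.1, w.2.2] F * MvPolynomial.eval ![w.1, w.2.1, w.2.2] G
  have hΦ : Continuous Φ := by
    have hc : Continuous fun w : ℝ × ℝ × ℝ => ![w.1, w.2.1, w.2.2] := by
      refine continuous_pi fun i => ?_
      fin_cases i
      · exact continuous_fst
      · exact continuous_snd.fst
      · exact continuous_snd.snd
    exact ((MvPolynomial.continuous_eval F).comp hc).mul ((MvPolynomial.continuous_eval G).comp hc)
  have h1 : ∫ w, Φ w ∂((volume.restrict Omega).withDensity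
      (fun w => ENNReal.ofReal (weight n w))) = polyInner n F G := by
    rw [integral_withDensity_eq_integral_toReal_smul (measurable_weight n).ennreal_ofReal
      (Filter.Eventually.of_forall fun _ => ENNReal.ofReal_lt_top)]
    refine setIntegral_congr_fun measurableSet_Omega fun w hw => ?_
    simp only [ENNReal.toReal_ofReal (weight_nonneg hw), smul_eq_mul, Φ]
    ring
  rw [← h1, map_innerTriple hn he, integral_smul_measure,
    integral_map (continuous_innerTriple e).measurable.aemeasurable hΦ.aestronglyMeasurable,
    ENNReal.toReal_ofReal (by positivity), smul_eq_mul]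
  rfl

end DoubleIntegral

/-! ### Linear isometries acting on harmonic polynomials. -/

section Substitution

open MvPolynomial

theorem pderiv_pderiv_comm {σ : Type*} (i j : σ) (p : MvPolynomial σ ℝ) :
    pderiv i (pderiv j p) = pderiv j (pderiv i p) := by
  classical
  -- A commutator of derivations is a derivation, so it suffices that it kills the variables.
  have h : ⁅(pderiv i : Derivation ℝ (MvPolynomial σ ℝ) (MvPolynomial σ ℝ)),
      (pderiv j : Derivation ℝ (MvPolynomial σ ℝ) (MvPolynomial σ ℝ))⁆ = 0 := by
    refine derivation_ext fun l => ?_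
    rw [Derivation.commutator_apply, pderiv_X, pderiv_X, Derivation.zero_apply, Pi.single_apply,
      Pi.single_apply]
    split_ifs <;> simp
  have := congrArg (fun D : Derivation ℝ (MvPolynomial σ ℝ) (MvPolynomial σ ℝ) => D p) h
  simpa [Derivation.commutator_apply, sub_eq_zero] using this

theorem pderiv_aeval {σ τ : Type*} [Fintype σ] (φ : σ → MvPolynomial τ ℝ) (c : τ)
    (p : MvPolynomial σ ℝ) :
    pderiv c (aeval φ p) = ∑ i, aeval φ (pderiv i p) * pderiv c (φ i) := by
  classical
  induction p using MvPolynomial.induction_on with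
  | C a => simp [algebraMap_eq]
  | add p q hp hq => simp only [map_add, hp, hq, add_mul, Finset.sum_add_distrib]
  | mul_X p j hp =>
    simp only [map_mul, aeval_X, pderiv_mul, hp, map_add, pderiv_X, add_mul,
      Finset.sum_add_distrib]
    congr 1
    · rw [Finset.sum_mul]
      exact Finset.sum_congr rfl fun i _ => by ring
    · rw [Finset.sum_eq_single j]
      · simp
      · intro i _ hi
        simp [hi.symm]
      · simp

theorem hasDerivAt_eval {σ : Type*} [Fintype σ] {c : ℝ → σ → ℝ} {c' : σ → ℝ} {θ : ℝ}
    (hc : ∀ i, HasDerivAt (fun s => c s i) (c' i) θ) (p : MvPolynomial σ ℝ) :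
    HasDerivAt (fun s => eval (c s) p) (∑ i, eval (c θ) (pderiv i p) * c' i) θ := by
  classical
  induction p using MvPolynomial.induction_on with
  | C a => simpa using hasDerivAt_const θ a
  | add p q hp hq =>
    have := hp.add hq
    simp only [map_add, add_mul, Finset.sum_add_distrib]
    exact this
  | mul_X p j hp =>
    have := hp.mul (hc j)
    simp only [map_mul, eval_X, pderiv_mul, map_add, pderiv_X, add_mul, Finset.sum_add_distrib]
    refine this.congr_deriv ?_
    congr 1
    · rw [Finset.sum_mul]
      exact Finset.sum_congr rfl fun i _ => by ring
    · rw [Finset.sum_eq_single j]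
      · simp
      · intro i _ hi
        simp [hi.symm]
      · simp

/-- The polynomial function at a point, as a linear functional. -/
def evalLin {m : ℕ} (z : Euc m) : MvPolynomial (Fin m) ℝ →ₗ[ℝ] ℝ :=
  (MvPolynomial.aeval (fun i => z i)).toLinearMap

@[simp] theorem evalLin_apply {m : ℕ} (z : Euc m) (p : MvPolynomial (Fin m) ℝ) :
    evalLin z p = evalAt z p := by
  simp [evalLin, evalAt]

theorem ext_evalAt {m : ℕ} {p q : MvPolynomial (Fin m) ℝ} (h : ∀ z, evalAt z p = evalAt z q) :
    p = q :=
  MvPolynomial.funext fun x => h (WithLp.toLp 2 x)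

/-- The coordinate functions of a linear isometry as linear polynomials. -/
def isoForm {m : ℕ} (g : Euc m ≃ₗᵢ[ℝ] Euc m) (i : Fin m) : MvPolynomial (Fin m) ℝ :=
  ∑ j, C (g (EuclideanSpace.single j 1) i) * X j

theorem sum_mul_single {m : ℕ} (g : Euc m ≃ₗᵢ[ℝ] Euc m) (z : Euc m) (i : Fin m) :
    ∑ j, g (EuclideanSpace.single j 1) i * z j = g z i := by
  have hz : z = ∑ j, z j • EuclideanSpace.single j (1 : ℝ) := by
    ext i
    simp [Pi.single_apply]
  conv_rhs => rw [hz, map_sum]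
  simp [mul_comm]

/-- Substitution of a linear isometry in a polynomial. -/
def compIso {m : ℕ} (g : Euc m ≃ₗᵢ[ℝ] Euc m) :
    MvPolynomial (Fin m) ℝ →ₐ[ℝ] MvPolynomial (Fin m) ℝ :=
  aeval (isoForm g)

theorem evalAt_compIso {m : ℕ} (g : Euc m ≃ₗᵢ[ℝ] Euc m) (p : MvPolynomial (Fin m) ℝ)
    (z : Euc m) : evalAt z (compIso g p) = evalAt (g z) p := by
  unfold evalAt compIso
  rw [← MvPolynomial.coe_aeval_eq_eval, ← MvPolynomial.coe_aeval_eq_eval]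
  simp only [RingHom.coe_coe]
  rw [← AlgHom.comp_apply, comp_aeval]
  congr 2
  funext i
  simp [isoForm, sum_mul_single]

theorem sum_isoForm_orthogonal {m : ℕ} (g : Euc m ≃ₗᵢ[ℝ] Euc m) (i j : Fin m) :
    ∑ c, g (EuclideanSpace.single c 1) i * g (EuclideanSpace.single c 1) j =
      if i = j then 1 else 0 := by
  have h : ∀ c k, g (EuclideanSpace.single c 1) k = g.symm (EuclideanSpace.single k 1) c := by
    intro c k
    have := g.symm.inner_map_map (g (EuclideanSpace.single c 1)) (EuclideanSpace.single k 1)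
    simpa [EuclideanSpace.inner_single_left, EuclideanSpace.inner_single_right] using this.symm
  have h2 := sum_mul_single g (g.symm (EuclideanSpace.single j 1)) i
  simp only [← h, LinearIsometryEquiv.apply_symm_apply] at h2
  rw [h2]
  simp

theorem laplacian_apply {m : ℕ} (p : MvPolynomial (Fin m) ℝ) :
    laplacian m p = ∑ i, pderiv i (pderiv i p) := by
  simp [laplacian]

theorem pderiv_isoForm {m : ℕ} (g : Euc m ≃ₗᵢ[ℝ] Euc m) (c i : Fin m) :
    pderiv c (isoForm g i) = C (g (EuclideanSpace.single c 1) i) := by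
  simp [isoForm, pderiv_X, Pi.single_apply]

/-- The chain rule used twice produces the Gram matrix of the rows of $g$, which is the identity. -/
theorem laplacian_compIso {m : ℕ} (g : Euc m ≃ₗᵢ[ℝ] Euc m) (p : MvPolynomial (Fin m) ℝ) :
    laplacian m (compIso g p) = compIso g (laplacian m p) := by
  have h : ∀ c (q : MvPolynomial (Fin m) ℝ), pderiv c (compIso g q) =
      ∑ i, C (g (EuclideanSpace.single c 1) i) * compIso g (pderiv i q) := fun c q => by
    rw [compIso, pderiv_aeval]
    exact Finset.sum_congr rfl fun i _ => by rw [pderiv_isoForm, mul_comm]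
  rw [laplacian_apply, laplacian_apply, map_sum]
  calc ∑ c, pderiv c (pderiv c (compIso g p))
      = ∑ c, ∑ i, ∑ j, C (g (EuclideanSpace.single c 1) i * g (EuclideanSpace.single c 1) j) *
          compIso g (pderiv j (pderiv i p)) := by
        refine Finset.sum_congr rfl fun c _ => ?_
        rw [h, map_sum]
        refine Finset.sum_congr rfl fun i _ => ?_
        rw [pderiv_C_mul, h, Finset.mul_sum]
        refine Finset.sum_congr rfl fun j _ => ?_
        rw [C_mul]; ring
    _ = ∑ i, ∑ j, (if i = j then 1 else 0) * compIso g (pderiv j (pderiv i p)) := by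
        rw [Finset.sum_comm]
        refine Finset.sum_congr rfl fun i _ => ?_
        rw [Finset.sum_comm]
        refine Finset.sum_congr rfl fun j _ => ?_
        rw [← Finset.sum_mul, ← map_sum, sum_isoForm_orthogonal, apply_ite C, C_1, C_0]
    _ = _ := by simp

theorem compIso_mem_harm {m k : ℕ} (g : Euc m ≃ₗᵢ[ℝ] Euc m) {p : MvPolynomial (Fin m) ℝ}
    (hp : p ∈ harm m k) : compIso g p ∈ harm m k := by
  refine ⟨?_, ?_⟩
  · have h1 : ∀ i, (isoForm g i).IsHomogeneous 1 := fun i => by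
      refine IsHomogeneous.sum _ _ _ fun j _ => ?_
      simpa using (isHomogeneous_C (Fin m) _).mul (isHomogeneous_X ℝ j)
    have := (hp.1 : p.IsHomogeneous k).aeval (isoForm g) h1
    rwa [one_mul] at this
  · have h2 : laplacian m p = 0 := hp.2
    rw [SetLike.mem_coe, LinearMap.mem_ker, laplacian_compIso, h2, map_zero]

/-- The action of a linear isometry on harmonic polynomials. -/
def harmIso {m k : ℕ} (g : Euc m ≃ₗᵢ[ℝ] Euc m) : harm m k →ₗ[ℝ] harm m k :=
  (compIso g).toLinearMap.restrict fun _ hp => compIso_mem_harm g hp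

@[simp] theorem evalAt_harmIso {m k : ℕ} (g : Euc m ≃ₗᵢ[ℝ] Euc m) (p : harm m k) (z : Euc m) :
    evalAt z (harmIso g p : MvPolynomial (Fin m) ℝ) = evalAt (g z) (p : MvPolynomial (Fin m) ℝ) :=
  evalAt_compIso g p z

end Substitution

/-! ### Infinitesimal rotations and the Casimir eigenvalue. -/

section Casimir

open MvPolynomial

/-- The infinitesimal rotation `x_a ∂_b - x_b ∂_a`. -/
def rotGen {m : ℕ} (a b : Fin m) : MvPolynomial (Fin m) ℝ →ₗ[ℝ] MvPolynomial (Fin m) ℝ where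
  toFun p := X a * pderiv b p - X b * pderiv a p
  map_add' p q := by simp only [map_add]; ring
  map_smul' c p := by simp [smul_sub]

theorem rotGen_apply {m : ℕ} (a b : Fin m) (p : MvPolynomial (Fin m) ℝ) :
    rotGen a b p = X a * pderiv b p - X b * pderiv a p := rfl

theorem laplacian_X_mul {m : ℕ} (a : Fin m) (p : MvPolynomial (Fin m) ℝ) :
    laplacian m (X a * p) = X a * laplacian m p + 2 * pderiv a p := by
  simp only [laplacian_apply, pderiv_mul, map_add, pderiv_X, Finset.sum_add_distrib,
    Pi.single_apply, apply_ite (pderiv _), map_zero, ite_mul, zero_mul,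
    one_mul, Finset.mul_sum]
  simp
  ring

theorem laplacian_pderiv {m : ℕ} (a : Fin m) (p : MvPolynomial (Fin m) ℝ) :
    laplacian m (pderiv a p) = pderiv a (laplacian m p) := by
  simp only [laplacian_apply, map_sum]
  refine Finset.sum_congr rfl fun i _ => ?_
  rw [pderiv_pderiv_comm i a p, pderiv_pderiv_comm i a]

theorem rotGen_mem_harm {m k : ℕ} (a b : Fin m) {p : MvPolynomial (Fin m) ℝ}
    (hp : p ∈ harm m k) : rotGen a b p ∈ harm m k := by
  have hl : laplacian m p = 0 := hp.2
  have hh : p.IsHomogeneous k := hp.1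
  refine ⟨?_, ?_⟩
  · rcases Nat.eq_zero_or_pos k with rfl | hk
    · have hC := totalDegree_eq_zero_iff_eq_C.1 ((totalDegree_zero_iff_isHomogeneous _).2 hh)
      rw [rotGen_apply, hC]
      simp
    · have h1 : ∀ i j : Fin m, (X i * pderiv j p).IsHomogeneous k := fun i j => by
        have := (isHomogeneous_X ℝ i).mul (hh.pderiv (i := j))
        rwa [Nat.add_sub_cancel' hk] at this
      exact (h1 a b).sub (h1 b a)
  · rw [SetLike.mem_coe, LinearMap.mem_ker, rotGen_apply, map_sub, laplacian_X_mul, laplacian_X_mul,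
      laplacian_pderiv, laplacian_pderiv, hl, pderiv_pderiv_comm a b]
    simp

/-- The Casimir operator is a scalar on the harmonic polynomials of a given degree. -/
theorem sum_rotGen_rotGen {m k : ℕ} {p : MvPolynomial (Fin m) ℝ} (hp : p ∈ harm m k) :
    ∑ a, ∑ b, rotGen a b (rotGen a b p) = (-2 * (k * (k + m - 2)) : ℝ) • p := by
  have hl : ∑ i, pderiv i (pderiv i p) = 0 := by rw [← laplacian_apply]; exact hp.2
  have hh : p.IsHomogeneous k := hp.1
  have hE : ∑ a, X a * pderiv a p = (k : MvPolynomial (Fin m) ℝ) * p := by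
    rw [hh.sum_X_mul_pderiv, nsmul_eq_mul]
  have hE2 : ∀ a, ∑ b, X b * pderiv b (pderiv a p) =
      ((k - 1 : ℕ) : MvPolynomial (Fin m) ℝ) * pderiv a p := fun a => by
    rw [(hh.pderiv (i := a)).sum_X_mul_pderiv, nsmul_eq_mul]
  -- Summed over $a,b$, harmonicity removes the second-derivative squares, and Euler's identity
  -- turns the rest into $(2k - 2mk - 2k(k-1))p$.
  have key : ∀ a b : Fin m, rotGen a b (rotGen a b p) =
      (if a = b then 2 * (X a * pderiv a p) else 0)
      + X a * X a * pderiv b (pderiv b p) + X b * X b * pderiv a (pderiv a p)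
      - X a * pderiv a p - X b * pderiv b p
      - X a * (X b * pderiv b (pderiv a p)) - X b * (X a * pderiv a (pderiv b p)) := by
    intro a b
    simp only [rotGen_apply, map_sub, pderiv_mul]
    by_cases h : a = b
    · subst h
      simp
      ring
    · simp only [pderiv_X_self, pderiv_X_of_ne h, pderiv_X_of_ne (Ne.symm h), if_neg h]
      rw [pderiv_pderiv_comm a b p]
      ring
  have hEE : ∑ a, ∑ b, X a * (X b * pderiv b (pderiv a p)) =
      ((k - 1 : ℕ) : MvPolynomial (Fin m) ℝ) * (k * p) := by
    simp only [← Finset.mul_sum, hE2, ← hE]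
    rw [Finset.mul_sum]
    exact Finset.sum_congr rfl fun a _ => by ring
  have hXX : ∑ a, ∑ b, X a * X a * pderiv b (pderiv b p) = (0 : MvPolynomial (Fin m) ℝ) := by
    simp only [← Finset.mul_sum, hl, mul_zero, Finset.sum_const_zero]
  have hXX' : ∑ a, ∑ b, X b * X b * pderiv a (pderiv a p) = (0 : MvPolynomial (Fin m) ℝ) := by
    rw [Finset.sum_comm, hXX]
  have hEE' : ∑ a, ∑ b, X b * (X a * pderiv a (pderiv b p)) =
      ((k - 1 : ℕ) : MvPolynomial (Fin m) ℝ) * (k * p) := by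
    rw [Finset.sum_comm, hEE]
  have hT : ∑ a : Fin m, ∑ b : Fin m, (if a = b then 2 * (X a * pderiv a p) else 0) =
      2 * (k * p : MvPolynomial (Fin m) ℝ) := by
    simp [← Finset.mul_sum, hE]
  have hS : ∑ _a : Fin m, ∑ b : Fin m, X b * pderiv b p =
      m * (k * p : MvPolynomial (Fin m) ℝ) := by
    simp [hE]
  have hS' : ∑ a : Fin m, ∑ _b : Fin m, X a * pderiv a p =
      m * (k * p : MvPolynomial (Fin m) ℝ) := by
    rw [Finset.sum_comm, hS]
  simp only [key, Finset.sum_add_distrib, Finset.sum_sub_distrib, hXX, hXX', hEE, hEE', hT, hS, hS']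
  rw [smul_eq_C_mul]
  -- The truncated `k - 1` is wrong only for $k=0$, where it is multiplied by $k$.
  rcases k with _ | k
  · simp
  · have h2 : (C 2 : MvPolynomial (Fin m) ℝ) = 2 := map_ofNat C 2
    simp only [Nat.add_sub_cancel, map_mul, map_sub, map_add, map_neg, map_natCast, h2]
    push_cast
    ring

end Casimir

/-! ### Invariant pairings of harmonic spaces vanish across degrees. -/

section InvariantPairing

open MvPolynomial

/-- The rotation by the angle `θ` in the plane of two coordinates. -/
def planeRotLin {m : ℕ} (a b : Fin m) (θ : ℝ) : Euc m →ₗ[ℝ] Euc m where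
  toFun z := z + ((Real.cos θ - 1) * z a - Real.sin θ * z b) • EuclideanSpace.single a (1 : ℝ) +
    (Real.sin θ * z a + (Real.cos θ - 1) * z b) • EuclideanSpace.single b (1 : ℝ)
  map_add' z w := by
    simp only [PiLp.add_apply]
    module
  map_smul' c z := by
    simp only [PiLp.smul_apply, smul_eq_mul, RingHom.id_apply]
    module

theorem planeRotLin_apply {m : ℕ} (a b : Fin m) (θ : ℝ) (z : Euc m) :
    planeRotLin a b θ z =
      z + ((Real.cos θ - 1) * z a - Real.sin θ * z b) • EuclideanSpace.single a (1 : ℝ) +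
      (Real.sin θ * z a + (Real.cos θ - 1) * z b) • EuclideanSpace.single b (1 : ℝ) := rfl

theorem norm_planeRotLin {m : ℕ} {a b : Fin m} (hab : a ≠ b) (θ : ℝ) (z : Euc m) :
    ‖planeRotLin a b θ z‖ = ‖z‖ := by
  rw [← sq_eq_sq₀ (norm_nonneg _) (norm_nonneg _), planeRotLin_apply, norm_add_sq_real,
    norm_add_sq_real]
  simp only [norm_smul, inner_add_left, inner_smul_right, EuclideanSpace.inner_single_right,
    PiLp.norm_single, mul_pow, Real.norm_eq_abs, sq_abs, norm_one]
  simp only [PiLp.smul_apply, PiLp.single_apply, hab.symm, if_false, conj_trivial, smul_zero]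
  have := Real.sin_sq_add_cos_sq θ
  linear_combination (z a ^ 2 + z b ^ 2) * this

/-- The rotation by the angle `θ` in a coordinate plane, as an isometry. -/
def planeRot {m : ℕ} {a b : Fin m} (hab : a ≠ b) (θ : ℝ) : Euc m ≃ₗᵢ[ℝ] Euc m :=
  LinearIsometry.toLinearIsometryEquiv ⟨planeRotLin a b θ, norm_planeRotLin hab θ⟩ rfl

theorem planeRot_apply {m : ℕ} {a b : Fin m} (hab : a ≠ b) (θ : ℝ) (z : Euc m) :
    planeRot hab θ z = planeRotLin a b θ z := rfl

theorem planeRot_zero {m : ℕ} {a b : Fin m} (hab : a ≠ b) (z : Euc m) : planeRot hab 0 z = z := by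
  simp [planeRot_apply, planeRotLin_apply]

theorem hasDerivAt_evalAt_planeRot {m : ℕ} {a b : Fin m} (hab : a ≠ b) (z : Euc m)
    (p : MvPolynomial (Fin m) ℝ) :
    HasDerivAt (fun θ => evalAt (planeRot hab θ z) p) (evalAt z (rotGen a b p)) 0 := by
  have h : ∀ i, HasDerivAt (fun θ => planeRot hab θ z i)
      (-(z b) * (if i = a then 1 else 0) + z a * (if i = b then 1 else 0)) 0 := by
    intro i
    have h1 := (((Real.hasDerivAt_cos 0).sub_const 1).mul_const (z a)).sub
      ((Real.hasDerivAt_sin 0).mul_const (z b))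
    have h2 := ((Real.hasDerivAt_sin 0).mul_const (z a)).add
      (((Real.hasDerivAt_cos 0).sub_const 1).mul_const (z b))
    have h3 := ((h1.mul_const (if i = a then 1 else 0)).const_add (z i)).add
      (h2.mul_const (if i = b then 1 else 0))
    refine (h3.congr_deriv (by simp)).congr_of_eventuallyEq (.of_forall fun θ => ?_)
    simp [planeRot_apply, planeRotLin_apply]
  have h4 := hasDerivAt_eval (c := fun θ i => planeRot hab θ z i) h p
  refine h4.congr_deriv ?_
  simp only [planeRot_zero, mul_add, Finset.sum_add_distrib]
  simp [evalAt, rotGen_apply]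
  ring

instance finiteDimensional_harm (m k : ℕ) : FiniteDimensional ℝ (harm m k) := by
  have : FiniteDimensional ℝ (homogeneousSubmodule (Fin m) ℝ k) :=
    Module.Finite.iff_fg.2 (homogeneousSubmodule_fg _ _ k)
  exact Submodule.finiteDimensional_of_le inf_le_left

/-- The action of an infinitesimal rotation on harmonic polynomials. -/
def harmGen {m k : ℕ} (a b : Fin m) : harm m k →ₗ[ℝ] harm m k :=
  (rotGen a b).restrict fun _ hp => rotGen_mem_harm a b hp

/-- A polynomial killed by all evaluations is zero. Differentiating a functional of a rotated
polynomial therefore reduces to differentiating its values at points. -/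
theorem span_evalAt_eq_top (m k : ℕ) :
    Submodule.span ℝ (Set.range fun z : Euc m => (evalLin z).comp (harm m k).subtype) = ⊤ := by
  set S := Submodule.span ℝ (Set.range fun z : Euc m => (evalLin z).comp (harm m k).subtype)
  have h : S.dualCoannihilator = ⊥ := by
    rw [eq_bot_iff]
    intro p hp
    rw [Submodule.mem_dualCoannihilator] at hp
    rw [Submodule.mem_bot]
    ext1
    refine ext_evalAt fun z => ?_
    have := hp _ (Submodule.subset_span ⟨z, rfl⟩)
    simpa [evalAt] using this
  rw [← Subspace.dualCoannihilator_dualAnnihilator_eq (W := S), h, Submodule.dualAnnihilator_bot]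

theorem hasDerivAt_functional_planeRot {m k : ℕ} {a b : Fin m} (hab : a ≠ b)
    (l : Module.Dual ℝ (harm m k)) (p : harm m k) :
    HasDerivAt (fun θ => l (harmIso (planeRot hab θ) p)) (l (harmGen a b p)) 0 := by
  have hl : l ∈ Submodule.span ℝ
      (Set.range fun z : Euc m => (evalLin z).comp (harm m k).subtype) := by
    rw [span_evalAt_eq_top]; trivial
  induction hl using Submodule.span_induction with
  | mem l hl =>
    obtain ⟨z, rfl⟩ := hl
    have h := hasDerivAt_evalAt_planeRot hab z (p : MvPolynomial (Fin m) ℝ)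
    simp only [LinearMap.comp_apply, Submodule.subtype_apply, evalLin_apply, evalAt_harmIso]
    exact h
  | zero => simpa using hasDerivAt_const (0 : ℝ) (0 : ℝ)
  | add l l' _ _ h h' => exact h.add h'
  | smul c l _ h => exact h.const_mul c

theorem harmIso_planeRot_zero {m k : ℕ} {a b : Fin m} (hab : a ≠ b) (p : harm m k) :
    harmIso (planeRot hab 0) p = p := by
  ext1
  refine ext_evalAt fun z => ?_
  rw [evalAt_harmIso, planeRot_zero]

/-- An invariant pairing is skew for infinitesimal rotations. -/
theorem invariant_pairing_harmGen {m k k' : ℕ} (B : harm m k →ₗ[ℝ] harm m k' →ₗ[ℝ] ℝ)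
    (hB : ∀ (g : Euc m ≃ₗᵢ[ℝ] Euc m) p q, B (harmIso g p) (harmIso g q) = B p q)
    (a b : Fin m) (p : harm m k) (q : harm m k') :
    B (harmGen a b p) q = -B p (harmGen a b q) := by
  by_cases hab : a = b
  · subst hab
    have h : ∀ {k} (p : harm m k), harmGen a a p = 0 := fun p => by
      ext1; exact sub_self _
    simp [h]
  let b₁ := Module.finBasis ℝ (harm m k)
  let b₂ := Module.finBasis ℝ (harm m k')
  -- In coordinates the pairing is a finite sum of products of functionals, so the product rule
  -- applies along the rotation. By invariance that function of the angle is constant.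
  have hexp : ∀ p q, B p q = ∑ i, ∑ j, b₁.coord i p * b₂.coord j q * B (b₁ i) (b₂ j) := by
    intro p q
    conv_lhs => rw [← b₁.sum_repr p, ← b₂.sum_repr q]
    simp only [map_sum, LinearMap.sum_apply, map_smul, LinearMap.smul_apply, smul_eq_mul,
      Module.Basis.coord_apply, Finset.mul_sum]
    rw [Finset.sum_comm]
    exact Finset.sum_congr rfl fun i _ => Finset.sum_congr rfl fun j _ => by ring
  have h1 : HasDerivAt (fun θ => B (harmIso (planeRot hab θ) p) (harmIso (planeRot hab θ) q))
      (B (harmGen a b p) q + B p (harmGen a b q)) 0 := by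
    rw [funext fun θ => hexp (harmIso (planeRot hab θ) p) (harmIso (planeRot hab θ) q),
      hexp (harmGen a b p), hexp p (harmGen a b q)]
    simp only [← Finset.sum_add_distrib]
    refine HasDerivAt.fun_sum fun i _ => HasDerivAt.fun_sum fun j _ => ?_
    have := ((hasDerivAt_functional_planeRot hab (b₁.coord i) p).mul
      (hasDerivAt_functional_planeRot hab (b₂.coord j) q)).mul_const (B (b₁ i) (b₂ j))
    refine this.congr_deriv ?_
    rw [harmIso_planeRot_zero, harmIso_planeRot_zero]
    ring
  simp only [hB] at h1
  have := h1.unique (hasDerivAt_const (0 : ℝ) (B p q))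
  linarith

/-- There is no invariant pairing between harmonic polynomials of different degrees. -/
theorem invariant_pairing_eq_zero {m k k' : ℕ} (hm : 2 ≤ m) (hk : k ≠ k')
    (B : harm m k →ₗ[ℝ] harm m k' →ₗ[ℝ] ℝ)
    (hB : ∀ (g : Euc m ≃ₗᵢ[ℝ] Euc m) p q, B (harmIso g p) (harmIso g q) = B p q)
    (p : harm m k) (q : harm m k') : B p q = 0 := by
  have hcas : ∀ {k} (p : harm m k), ∑ a : Fin m, ∑ b : Fin m, harmGen a b (harmGen a b p) =
      (-2 * (k * (k + m - 2)) : ℝ) • p := fun p => by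
    ext1
    simp only [Submodule.coe_sum, Submodule.coe_smul]
    exact sum_rotGen_rotGen p.2
  -- Two applications of skewness cancel in sign: the Casimir operator is self-adjoint for `B`.
  have h1 : B (∑ a : Fin m, ∑ b : Fin m, harmGen a b (harmGen a b p)) q =
      B p (∑ a : Fin m, ∑ b : Fin m, harmGen a b (harmGen a b q)) := by
    simp only [map_sum, LinearMap.sum_apply, invariant_pairing_harmGen B hB, neg_neg]
  rw [hcas, hcas] at h1
  simp only [map_smul, LinearMap.smul_apply, smul_eq_mul] at h1
  have h2 : ((k : ℝ) - k') * ((k + k' + m - 2 : ℝ) * B p q) = 0 := by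
    linear_combination (-1 / 2 : ℝ) * h1
  have h3 : ((k : ℝ) - k') ≠ 0 := sub_ne_zero.2 (by exact_mod_cast hk)
  -- Distinct degrees give $k+k'\ge 1$, which with $m\ge 2$ makes this factor positive.
  have h4 : (k + k' + m - 2 : ℝ) ≠ 0 := by
    have : (3 : ℝ) ≤ k + k' + m := by
      have : 3 ≤ k + k' + m := by omega
      exact_mod_cast this
    linarith
  simpa [h3, h4] using h2

end InvariantPairing

/-! ### Orthogonality of spherical harmonics of different degrees. -/

section SphereInner

theorem continuous_evalAt {n : ℕ} (p : MvPolynomial (Fin n) ℝ) :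
    Continuous fun x : Sph n => evalAt (x : Euc n) p := by
  unfold evalAt
  exact (MvPolynomial.continuous_eval p).comp (by fun_prop)

theorem continuous_of_mem_sphHarm {n k : ℕ} {f : Sph n → ℝ} (hf : f ∈ sphHarm n k) :
    Continuous f := by
  obtain ⟨p, -, rfl⟩ := hf
  exact continuous_evalAt p

theorem integrable_of_continuous_sph {n : ℕ} {f : Sph n → ℝ} (hf : Continuous f) :
    Integrable f (sphMeasure n) :=
  hf.integrable_of_hasCompactSupport (HasCompactSupport.of_compactSpace f)

theorem sphInner_comp_rot {n : ℕ} (g : Euc n ≃ₗᵢ[ℝ] Euc n) {f f' : Sph n → ℝ}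
    (hf : Continuous f) (hf' : Continuous f') :
    sphInner n (fun x => f (rot g x)) (fun x => f' (rot g x)) = sphInner n f f' := by
  unfold sphInner
  have h := measurePreserving_rot g
  conv_rhs => rw [← h.map_eq]
  have hm : AEStronglyMeasurable (fun x => f x * f' x) (Measure.map (rot g) (sphMeasure n)) :=
    (hf.mul hf').aestronglyMeasurable
  rw [integral_map h.measurable.aemeasurable hm]

theorem integrable_mul_of_continuous_sph {n : ℕ} {f f' : Sph n → ℝ} (hf : Continuous f)
    (hf' : Continuous f') : Integrable (fun x => f x * f' x) (sphMeasure n) :=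
  integrable_of_continuous_sph (hf.mul hf')

/-- The scalar product of the sphere vanishes on the images of harmonic spaces of different
degrees under linear maps for which it is invariant. -/
theorem sphInner_eq_zero_of_invariant {n m k k' : ℕ} (hm : 2 ≤ m) (hk : k ≠ k')
    (Φ : harm m k →ₗ[ℝ] (Sph n → ℝ)) (Φ' : harm m k' →ₗ[ℝ] (Sph n → ℝ))
    (hΦ : ∀ p, Continuous (Φ p)) (hΦ' : ∀ q, Continuous (Φ' q))
    (hinv : ∀ (g : Euc m ≃ₗᵢ[ℝ] Euc m) p q,
      sphInner n (Φ (harmIso g p)) (Φ' (harmIso g q)) = sphInner n (Φ p) (Φ' q))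
    (p : harm m k) (q : harm m k') : sphInner n (Φ p) (Φ' q) = 0 := by
  have hint : ∀ p q, Integrable (fun x => Φ p x * Φ' q x) (sphMeasure n) := fun p q =>
    integrable_mul_of_continuous_sph (hΦ p) (hΦ' q)
  exact invariant_pairing_eq_zero hm hk
    (LinearMap.mk₂ ℝ (fun p q => sphInner n (Φ p) (Φ' q))
      (fun p₁ p₂ q => by
        simp only [sphInner, map_add, Pi.add_apply, add_mul]
        rw [integral_add (hint _ _) (hint _ _), mul_add])
      (fun c p q => by
        simp only [sphInner, map_smul, Pi.smul_apply, smul_eq_mul, mul_assoc]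
        rw [integral_const_mul]
        ring)
      (fun p q₁ q₂ => by
        simp only [sphInner, map_add, Pi.add_apply, mul_add]
        rw [integral_add (hint _ _) (hint _ _), mul_add])
      (fun c p q => by
        simp only [sphInner, map_smul, Pi.smul_apply, smul_eq_mul, mul_left_comm _ c]
        rw [integral_const_mul]
        ring))
    hinv p q

/-- Spherical harmonics of different degrees are orthogonal. -/
theorem sphInner_eq_zero_of_degree_ne {n i i' : ℕ} (hn : 2 ≤ n) (hi : i ≠ i') {f f' : Sph n → ℝ}
    (hf : f ∈ sphHarm n i) (hf' : f' ∈ sphHarm n i') : sphInner n f f' = 0 := by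
  obtain ⟨p, hp, rfl⟩ := hf
  obtain ⟨q, hq, rfl⟩ := hf'
  refine sphInner_eq_zero_of_invariant hn hi ((restrictSph n).comp (harm n i).subtype)
    ((restrictSph n).comp (harm n i').subtype) (fun p => continuous_evalAt _)
    (fun p => continuous_evalAt _) (fun g p q => ?_) ⟨p, hp⟩ ⟨q, hq⟩
  refine Eq.trans ?_ (sphInner_comp_rot g (continuous_evalAt p.1) (continuous_evalAt q.1))
  congr 1
  · funext x
    exact evalAt_harmIso g p x
  · funext x
    exact evalAt_harmIso g q x

end SphereInner

/-! ### Copies of harmonic spaces under the stabilizer of $e$, and adapted bases. -/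

section Copies

/-- An orthonormal basis made of a unit vector and an isometric image of the standard basis in its
orthogonal complement. -/
theorem exists_orthonormalBasis_cons {m : ℕ} {e : Euc (m + 1)} (he : ‖e‖ = 1)
    (ι : Euc m →ₗᵢ[ℝ] Euc (m + 1)) (hι : ∀ z, ⟪e, ι z⟫ = 0) :
    ∃ b : OrthonormalBasis (Fin (m + 1)) ℝ (Euc (m + 1)), b 0 = e ∧
      ∀ i : Fin m, b i.succ = ι (EuclideanSpace.single i 1) := by
  let v : Fin (m + 1) → Euc (m + 1) := Fin.cons e fun i => ι (EuclideanSpace.single i 1)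
  have hv : Orthonormal ℝ v := by
    rw [orthonormal_iff_ite]
    intro i j
    refine Fin.cases ?_ (fun i => ?_) i <;> refine Fin.cases ?_ (fun j => ?_) j
    · simp [v, he]
    · simp [v, hι, (Fin.succ_ne_zero j).symm]
    · simp [v, real_inner_comm, hι]
    · simp [v, EuclideanSpace.inner_single_left]
  have hv' : Orthonormal ℝ ((Set.univ : Set (Fin (m + 1))).domRestrict v) :=
    hv.comp _ Subtype.val_injective
  obtain ⟨b, hb⟩ := hv'.exists_orthonormalBasis_extension_of_card_eq (by simp)
  exact ⟨b, hb 0 trivial, fun i => hb i.succ trivial⟩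

/-- With $\iota' = \iota\circ g'$ this lifts every $g'\in \mathrm O(\mathbb R^{n-1})$ to an element
of $H$. -/
theorem exists_isometry_intertwining {m : ℕ} {e : Euc (m + 1)} (he : ‖e‖ = 1)
    (ι ι' : Euc m →ₗᵢ[ℝ] Euc (m + 1)) (hι : ∀ z, ⟪e, ι z⟫ = 0) (hι' : ∀ z, ⟪e, ι' z⟫ = 0) :
    ∃ g : Euc (m + 1) ≃ₗᵢ[ℝ] Euc (m + 1), g e = e ∧ ∀ z, g (ι z) = ι' z := by
  obtain ⟨b, hb0, hb⟩ := exists_orthonormalBasis_cons he ι hι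
  obtain ⟨b', hb0', hb'⟩ := exists_orthonormalBasis_cons he ι' hι'
  refine ⟨b.equiv b' (Equiv.refl _), ?_, fun z => ?_⟩
  · rw [← hb0, OrthonormalBasis.equiv_apply_basis, Equiv.refl_apply, hb0', hb0]
  · have h : (b.equiv b' (Equiv.refl _)).toLinearEquiv.toLinearMap ∘ₗ ι.toLinearMap =
        ι'.toLinearMap := by
      refine (EuclideanSpace.basisFun (Fin m) ℝ).toBasis.ext fun i => ?_
      simp [← hb, ← hb']
    exact LinearMap.congr_fun h z

theorem range_isometry_eq {m : ℕ} {e : Euc (m + 1)} (he : ‖e‖ = 1)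
    (ι : Euc m →ₗᵢ[ℝ] Euc (m + 1)) (hι : ∀ z, ⟪e, ι z⟫ = 0) :
    LinearMap.range ι.toLinearMap = (Submodule.span ℝ {e})ᗮ := by
  refine Submodule.eq_of_le_of_finrank_eq ?_ ?_
  · rintro _ ⟨z, rfl⟩
    exact Submodule.mem_orthogonal_singleton_iff_inner_right.2 (hι z)
  · have he0 : e ≠ 0 := by rintro rfl; simp at he
    have : Fact (Module.finrank ℝ (Euc (m + 1)) = m + 1) := ⟨by simp⟩
    rw [LinearMap.finrank_range_of_inj ι.injective, Submodule.finrank_orthogonal_span_singleton (n := m) he0]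
    simp

/-- Both isometries have image $e^\perp$. Two copies may be given with different identifications of
$e^\perp$, and `r` translates between them. -/
theorem exists_isometry_comp {m : ℕ} {e : Euc (m + 1)} (he : ‖e‖ = 1)
    (ι ι' : Euc m →ₗᵢ[ℝ] Euc (m + 1)) (hι : ∀ z, ⟪e, ι z⟫ = 0) (hι' : ∀ z, ⟪e, ι' z⟫ = 0) :
    ∃ r : Euc m ≃ₗᵢ[ℝ] Euc m, ∀ z, ι (r z) = ι' z := by
  have hmem : ∀ z, ∃ w, ι w = ι' z := fun z => by
    have : ι' z ∈ LinearMap.range ι.toLinearMap := by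
      rw [range_isometry_eq he ι hι, ← range_isometry_eq he ι' hι']
      exact ⟨z, rfl⟩
    exact this
  choose r hr using hmem
  let rl : Euc m →ₗᵢ[ℝ] Euc m :=
    { toFun := r
      map_add' := fun x y => ι.injective (by simp [hr])
      map_smul' := fun c x => ι.injective (by simp [hr])
      norm_map' := fun x => by
        change ‖r x‖ = ‖x‖
        rw [← ι.norm_map, hr, ι'.norm_map] }
  exact ⟨rl.toLinearIsometryEquiv rfl, hr⟩

/-- Copies of harmonic spaces of different degrees are orthogonal. -/
theorem sphInner_eq_zero_of_copies {n k k' i i' : ℕ} (hn : 3 ≤ n) {e : Euc n} (he : ‖e‖ = 1)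
    (hk : k ≠ k') {W W' : Submodule ℝ (Sph n → ℝ)} (hW : IsCopyOfHarm n e k i W)
    (hW' : IsCopyOfHarm n e k' i' W') {f f' : Sph n → ℝ} (hf : f ∈ W) (hf' : f' ∈ W') :
    sphInner n f f' = 0 := by
  obtain ⟨m, rfl⟩ : ∃ m, n = m + 1 := ⟨n - 1, by omega⟩
  obtain ⟨hWi, ι, hι, φ, hφ⟩ := hW
  obtain ⟨hWi', ι', hι', φ', hφ'⟩ := hW'
  change Euc m →ₗᵢ[ℝ] Euc (m + 1) at ι ι'
  change harm m k ≃ₗ[ℝ] W at φ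
  change harm m k' ≃ₗ[ℝ] W' at φ'
  obtain ⟨r, hr⟩ := exists_isometry_comp he ι ι' hι hι'
  have hc : ∀ p, Continuous (φ p : Sph (m + 1) → ℝ) := fun p =>
    continuous_of_mem_sphHarm (hWi (φ p).2)
  have hc' : ∀ p, Continuous (φ' p : Sph (m + 1) → ℝ) := fun p =>
    continuous_of_mem_sphHarm (hWi' (φ' p).2)
  have h := sphInner_eq_zero_of_invariant (by omega : 2 ≤ m) hk
    (W.subtype ∘ₗ φ.toLinearMap) (W'.subtype ∘ₗ φ'.toLinearMap ∘ₗ harmIso r)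
    (fun p => hc p) (fun p => hc' (harmIso r p)) ?_ (φ.symm ⟨f, hf⟩)
    (harmIso r.symm (φ'.symm ⟨f', hf'⟩))
  · have h1 : harmIso r (harmIso r.symm (φ'.symm ⟨f', hf'⟩)) = φ'.symm ⟨f', hf'⟩ := by
      ext1
      refine ext_evalAt fun z => ?_
      rw [evalAt_harmIso, evalAt_harmIso, r.symm_apply_apply]
    simpa [h1] using h
  · intro g' p q
    obtain ⟨g, hge, hg⟩ := exists_isometry_intertwining he ι (ι.comp g'.toLinearIsometry) hι
      (fun z => hι (g' z))
    refine Eq.trans ?_ (sphInner_comp_rot g (hc p) (hc' (harmIso r q)))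
    congr 1
    · funext x
      exact hφ g hge g' hg p (harmIso g' p) (fun z => evalAt_harmIso g' p z) x
    · funext x
      -- Seen through $\iota' = \iota\circ r$, the rotation $g$ acts as the conjugate $r^{-1}g'r$.
      refine hφ' g hge ((r.trans g').trans r.symm) (fun z => ?_) (harmIso r q)
        (harmIso r (harmIso g' q)) (fun z => ?_) x
      · have h2 := hr (r.symm (g' (r z)))
        rw [r.apply_symm_apply] at h2
        exact ((congrArg g (hr z)).symm.trans (hg (r z))).trans h2
      · refine (evalAt_harmIso r (harmIso g' q) z).trans ?_
        refine (evalAt_harmIso g' q (r z)).trans ?_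
        refine Eq.symm ((evalAt_harmIso r q _).trans ?_)
        exact congrArg (fun w => evalAt w (q : MvPolynomial (Fin m) ℝ))
          (r.apply_symm_apply (g' (r z)))

/-- The space spanned by an adapted basis is a copy of the harmonic space. -/
theorem IsAdaptedBasis.isCopyOfHarm {n d k : ℕ} {e : Euc n}
    {b : Fin (d - k + 1) → Fin (harmDim (n - 1) k) → Sph n → ℝ} (hb : IsAdaptedBasis n e d k b)
    (hk : 0 < harmDim (n - 1) k) (s : Fin (d - k + 1)) :
    IsCopyOfHarm n e k (k + s) (subHarm n e k (k + s)) := by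
  have hmem : ∀ m, b s m ∈ subHarm n e k (k + s) := fun m => by
    rw [← hb.span_eq s]
    exact Submodule.subset_span ⟨m, rfl⟩
  -- Without any copy the supremum would be zero, which contains no function of norm 1.
  have hne : ∃ W, IsCopyOfHarm n e k (k + s) W := by
    by_contra hc
    push Not at hc
    have h0 : subHarm n e k (k + s) = ⊥ := by
      unfold subHarm
      rw [sSup_eq_bot]
      exact fun W hW => absurd hW (hc W)
    have h1 := hmem ⟨0, hk⟩
    rw [h0, Submodule.mem_bot] at h1
    have h2 := hb.orthonormal s ⟨0, hk⟩ ⟨0, hk⟩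
    rw [h1] at h2
    simp [sphInner] at h2
  obtain ⟨W, hW⟩ := hne
  have hle : W ≤ subHarm n e k (k + s) := le_sSup hW
  have hfin : FiniteDimensional ℝ (subHarm n e k (k + s)) := by
    rw [← hb.span_eq s]
    exact FiniteDimensional.span_of_finite ℝ (Set.finite_range _)
  -- The copy has dimension $h_k^{n-1}$, and the supremum is spanned by that many functions.
  have heq : W = subHarm n e k (k + s) := by
    refine Submodule.eq_of_le_of_finrank_le hle ?_
    obtain ⟨-, -, -, φ, -⟩ := id hW
    rw [← φ.finrank_eq, ← hb.span_eq s]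
    refine (finrank_range_le_card (b s)).trans ?_
    rw [Fintype.card_fin]
    rfl
  rwa [← heq]

theorem IsAdaptedBasis.mem_subHarm {n d k : ℕ} {e : Euc n}
    {b : Fin (d - k + 1) → Fin (harmDim (n - 1) k) → Sph n → ℝ} (hb : IsAdaptedBasis n e d k b)
    (s : Fin (d - k + 1)) (m : Fin (harmDim (n - 1) k)) : b s m ∈ subHarm n e k (k + s) := by
  rw [← hb.span_eq s]
  exact Submodule.subset_span ⟨m, rfl⟩

theorem IsAdaptedBasis.mem_sphHarm {n d k : ℕ} {e : Euc n}
    {b : Fin (d - k + 1) → Fin (harmDim (n - 1) k) → Sph n → ℝ} (hb : IsAdaptedBasis n e d k b)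
    (s : Fin (d - k + 1)) (m : Fin (harmDim (n - 1) k)) : b s m ∈ sphHarm n (k + s) :=
  (hb.isCopyOfHarm m.pos s).1 (hb.mem_subHarm s m)

theorem IsAdaptedBasis.sphInner_eq {n d k : ℕ} (hn : 3 ≤ n) {e : Euc n}
    {b : Fin (d - k + 1) → Fin (harmDim (n - 1) k) → Sph n → ℝ} (hb : IsAdaptedBasis n e d k b)
    (s s' : Fin (d - k + 1)) (m m' : Fin (harmDim (n - 1) k)) :
    sphInner n (b s m) (b s' m') = if s = s' ∧ m = m' then 1 else 0 := by
  by_cases hs : s = s'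
  · subst hs
    simp [hb.orthonormal]
  · rw [if_neg (fun h => hs h.1)]
    refine sphInner_eq_zero_of_degree_ne (by omega) ?_ (hb.mem_sphHarm s m) (hb.mem_sphHarm s' m')
    have := Fin.val_ne_of_ne hs
    omega

theorem IsAdaptedBasis.sphInner_eq_zero {n d k k' : ℕ} (hn : 3 ≤ n) {e : Euc n} (he : ‖e‖ = 1)
    (hk : k ≠ k')
    {b : Fin (d - k + 1) → Fin (harmDim (n - 1) k) → Sph n → ℝ} (hb : IsAdaptedBasis n e d k b)
    {b' : Fin (d - k' + 1) → Fin (harmDim (n - 1) k') → Sph n → ℝ}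
    (hb' : IsAdaptedBasis n e d k' b') (s : Fin (d - k + 1)) (s' : Fin (d - k' + 1))
    (m : Fin (harmDim (n - 1) k)) (m' : Fin (harmDim (n - 1) k')) :
    sphInner n (b s m) (b' s' m') = 0 :=
  sphInner_eq_zero_of_copies hn he hk (hb.isCopyOfHarm m.pos s) (hb'.isCopyOfHarm m'.pos s')
    (hb.mem_subHarm s m) (hb'.mem_subHarm s' m')

end Copies

/-! ### From orthonormal functions to zonal matrices. -/

section Zonal

/-- The scalar product of two polynomials which restrict to sums of products on the sphere. -/
theorem polyInner_eq_sum {n : ℕ} (hn : 3 ≤ n) {e : Euc n} (he : ‖e‖ = 1) {κ κ' : Type*}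
    [Fintype κ] [Fintype κ'] {α β : κ → Sph n → ℝ} {α' β' : κ' → Sph n → ℝ} {F G : Poly3}
    (hα : ∀ p, Continuous (α p)) (hβ : ∀ p, Continuous (β p))
    (hα' : ∀ p, Continuous (α' p)) (hβ' : ∀ p, Continuous (β' p)) {c : κ → ℝ} {c' : κ' → ℝ}
    (hF : ∀ x y : Sph n, MvPolynomial.eval ![⟪e, (x : Euc n)⟫, ⟪e, (y : Euc n)⟫,
      ⟪(x : Euc n), (y : Euc n)⟫] F = ∑ p, c p * (α p x * β p y))
    (hG : ∀ x y : Sph n, MvPolynomial.eval ![⟪e, (x : Euc n)⟫, ⟪e, (y : Euc n)⟫,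
      ⟪(x : Euc n), (y : Euc n)⟫] G = ∑ p, c' p * (α' p x * β' p y)) :
    polyInner n F G =
      ∑ p, ∑ p', c p * c' p' * (sphInner n (α p) (α' p') * sphInner n (β p) (β' p')) := by
  rw [polyInner_eq_integral hn he]
  simp only [hF, hG, Finset.sum_mul_sum]
  have hint : ∀ p p', Integrable (fun z : Sph n × Sph n =>
      c p * (α p z.1 * β p z.2) * (c' p' * (α' p' z.1 * β' p' z.2)))
      ((sphMeasure n).prod (sphMeasure n)) := fun p p' => by
    have h1 := hα p
    have h2 := hβ p
    have h3 := hα' p'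
    have h4 := hβ' p'
    exact (Continuous.integrable_of_hasCompactSupport (by fun_prop)
      (HasCompactSupport.of_compactSpace _))
  rw [integral_finsetSum _ fun p _ => integrable_finsetSum _ fun p' _ => hint p p', Finset.mul_sum]
  refine Finset.sum_congr rfl fun p _ => ?_
  rw [integral_finsetSum _ fun p' _ => hint p p', Finset.mul_sum]
  refine Finset.sum_congr rfl fun p' _ => ?_
  have h : ∀ z : Sph n × Sph n, c p * (α p z.1 * β p z.2) * (c' p' * (α' p' z.1 * β' p' z.2)) =
      c p * c' p' * ((α p z.1 * α' p' z.1) * (β p z.2 * β' p' z.2)) := fun z => by ring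
  simp only [h]
  rw [integral_const_mul, integral_prod_mul (fun x => α p x * α' p' x) (fun y => β p y * β' p' y)]
  unfold sphInner
  field_simp

theorem ZMat_apply {n d k : ℕ} (b : Fin (d - k + 1) → Fin (harmDim (n - 1) k) → Sph n → ℝ)
    (x y : Sph n) (i j : Fin (d - k + 1)) :
    ZMat b x y i j = (harmDim (n - 1) k : ℝ)⁻¹ * ∑ m, b i m x * b j m y := by
  simp only [ZMat, EMat, Matrix.mul_apply, Matrix.transpose_apply, Matrix.smul_apply,
    Matrix.of_apply, smul_eq_mul, Finset.mul_sum]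
  refine Finset.sum_congr rfl fun m _ => ?_
  have h : (1 / √(harmDim (n - 1) k : ℝ)) * (1 / √(harmDim (n - 1) k : ℝ)) =
      (harmDim (n - 1) k : ℝ)⁻¹ := by
    rw [div_mul_div_comm, Real.mul_self_sqrt (Nat.cast_nonneg _), one_mul, one_div]
  rw [← h]
  ring

theorem matInner_eq_sum {N : ℕ} {R : Type} [CommRing R] (A B : Matrix (Fin N) (Fin N) R) :
    matInner A B = ∑ i, ∑ j, A i j * B i j := by
  simp [matInner, Matrix.trace, Matrix.mul_apply]

/-- `F` restricts to the kernel `⟨A, Z(x, y)⟩` on the sphere. -/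
def RestrictsTo {n d k : ℕ} (e : Euc n) (b : Fin (d - k + 1) → Fin (harmDim (n - 1) k) → Sph n → ℝ)
    (A : Matrix (Fin (d - k + 1)) (Fin (d - k + 1)) ℝ) (F : Poly3) : Prop :=
  ∀ x y : Sph n, MvPolynomial.eval ![⟪e, (x : Euc n)⟫, ⟪e, (y : Euc n)⟫,
    ⟪(x : Euc n), (y : Euc n)⟫] F = matInner A (ZMat b x y)

theorem RestrictsTo.eval_eq {n d k : ℕ} {e : Euc n}
    {b : Fin (d - k + 1) → Fin (harmDim (n - 1) k) → Sph n → ℝ}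
    {A : Matrix (Fin (d - k + 1)) (Fin (d - k + 1)) ℝ} {F : Poly3} (h : RestrictsTo e b A F)
    (x y : Sph n) :
    MvPolynomial.eval ![⟪e, (x : Euc n)⟫, ⟪e, (y : Euc n)⟫, ⟪(x : Euc n), (y : Euc n)⟫] F =
      ∑ p : Fin (d - k + 1) × Fin (d - k + 1) × Fin (harmDim (n - 1) k),
        (A p.1 p.2.1 * (harmDim (n - 1) k : ℝ)⁻¹) * (b p.1 p.2.2 x * b p.2.1 p.2.2 y) := by
  rw [h, matInner_eq_sum, Fintype.sum_prod_type]
  refine Finset.sum_congr rfl fun i _ => ?_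
  rw [Fintype.sum_prod_type]
  refine Finset.sum_congr rfl fun j _ => ?_
  rw [ZMat_apply, ← mul_assoc, Finset.mul_sum]

theorem IsAdaptedBasis.polyInner_eq {n d k : ℕ} (hn : 3 ≤ n) {e : Euc n} (he : ‖e‖ = 1)
    {b : Fin (d - k + 1) → Fin (harmDim (n - 1) k) → Sph n → ℝ} (hb : IsAdaptedBasis n e d k b)
    {A B : Matrix (Fin (d - k + 1)) (Fin (d - k + 1)) ℝ} {F G : Poly3} (hF : RestrictsTo e b A F)
    (hG : RestrictsTo e b B G) :
    polyInner n F G = matInner A B / (harmDim (n - 1) k : ℝ) := by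
  have hc : ∀ i m, Continuous (b i m) := fun i m => continuous_of_mem_sphHarm (hb.mem_sphHarm i m)
  rw [polyInner_eq_sum hn he (fun p => hc _ _) (fun p => hc _ _) (fun p => hc _ _)
    (fun p => hc _ _) hF.eval_eq hG.eval_eq]
  -- The products $e_{i,m}(x)e_{j,m}(y)$ are orthonormal. Summing the diagonal over $m$ then gives
  -- $h\cdot h^{-2} = h^{-1}$.
  have h : ∀ p p' : Fin (d - k + 1) × Fin (d - k + 1) × Fin (harmDim (n - 1) k),
      sphInner n (b p.1 p.2.2) (b p'.1 p'.2.2) * sphInner n (b p.2.1 p.2.2) (b p'.2.1 p'.2.2) =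
        if p = p' then 1 else 0 := by
    rintro ⟨i, j, m⟩ ⟨i', j', m'⟩
    rw [hb.sphInner_eq hn, hb.sphInner_eq hn]
    by_cases h1 : i = i' <;> by_cases h2 : j = j' <;> by_cases h3 : m = m' <;> simp [h1, h2, h3]
  simp only [h, mul_ite, mul_one, mul_zero, Finset.sum_ite_eq, Finset.mem_univ, if_true]
  rw [matInner_eq_sum, Fintype.sum_prod_type, Finset.sum_div]
  refine Finset.sum_congr rfl fun i _ => ?_
  rw [Fintype.sum_prod_type, Finset.sum_div]
  refine Finset.sum_congr rfl fun j _ => ?_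
  dsimp only
  rw [Finset.sum_const, Finset.card_univ, Fintype.card_fin, nsmul_eq_mul]
  -- Division by zero makes both sides vanish in the first case, so positivity of the dimension is
  -- not needed.
  rcases eq_or_ne (harmDim (n - 1) k : ℝ) 0 with h0 | h0
  · simp [h0]
  · field_simp

theorem IsAdaptedBasis.polyInner_eq_zero {n d k k' : ℕ} (hn : 3 ≤ n) {e : Euc n} (he : ‖e‖ = 1)
    (hk : k ≠ k')
    {b : Fin (d - k + 1) → Fin (harmDim (n - 1) k) → Sph n → ℝ} (hb : IsAdaptedBasis n e d k b)
    {b' : Fin (d - k' + 1) → Fin (harmDim (n - 1) k') → Sph n → ℝ}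
    (hb' : IsAdaptedBasis n e d k' b') {A : Matrix (Fin (d - k + 1)) (Fin (d - k + 1)) ℝ}
    {B : Matrix (Fin (d - k' + 1)) (Fin (d - k' + 1)) ℝ} {F G : Poly3}
    (hF : RestrictsTo e b A F) (hG : RestrictsTo e b' B G) :
    polyInner n F G = 0 := by
  have hc : ∀ i m, Continuous (b i m) := fun i m => continuous_of_mem_sphHarm (hb.mem_sphHarm i m)
  have hc' : ∀ i m, Continuous (b' i m) := fun i m =>
    continuous_of_mem_sphHarm (hb'.mem_sphHarm i m)
  rw [polyInner_eq_sum hn he (fun p => hc _ _) (fun p => hc _ _) (fun p => hc' _ _)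
    (fun p => hc' _ _) hF.eval_eq hG.eval_eq]
  simp [hb.sphInner_eq_zero hn he hk hb']

theorem matInner_single_left {N : ℕ} {R : Type} [CommRing R] (i j : Fin N)
    (B : Matrix (Fin N) (Fin N) R) : matInner (Matrix.single i j 1) B = B i j := by
  rw [matInner_eq_sum, Finset.sum_eq_single i, Finset.sum_eq_single j]
  · simp
  · intro j' _ hj
    simp [hj.symm]
  · simp
  · intro i' _ hi
    simp [hi.symm]
  · simp

/-- Matrix units put part (a) in the same form as part (b). -/
theorem restrictsTo_entry {n d k : ℕ} {e : Euc n}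
    {b : Fin (d - k + 1) → Fin (harmDim (n - 1) k) → Sph n → ℝ}
    {Y : Matrix (Fin (d - k + 1)) (Fin (d - k + 1)) Poly3}
    (hY : ∀ x y : Sph n, ZMat b x y = Y.map (MvPolynomial.eval
      ![⟪e, (x : Euc n)⟫, ⟪e, (y : Euc n)⟫, ⟪(x : Euc n), (y : Euc n)⟫]))
    (i j : Fin (d - k + 1)) : RestrictsTo e b (Matrix.single i j 1) (Y i j) := fun x y => by
  rw [matInner_single_left, hY, Matrix.map_apply]

theorem ZMat_swap {n d k : ℕ} (b : Fin (d - k + 1) → Fin (harmDim (n - 1) k) → Sph n → ℝ)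
    (x y : Sph n) (i j : Fin (d - k + 1)) : ZMat b y x i j = ZMat b x y j i := by
  simp only [ZMat_apply, mul_comm]

/-- Exchanging $u$ and $v$ exchanges $x$ and $y$, which transposes the kernel matrix; pairing with a
symmetric matrix does not see the transposition. -/
theorem restrictsTo_symmetrized {n d k : ℕ} {e : Euc n}
    {b : Fin (d - k + 1) → Fin (harmDim (n - 1) k) → Sph n → ℝ}
    {Y : Matrix (Fin (d - k + 1)) (Fin (d - k + 1)) Poly3}
    (hY : ∀ x y : Sph n, ZMat b x y = Y.map (MvPolynomial.eval
      ![⟪e, (x : Euc n)⟫, ⟪e, (y : Euc n)⟫, ⟪(x : Euc n), (y : Euc n)⟫]))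
    {A : Matrix (Fin (d - k + 1)) (Fin (d - k + 1)) ℝ} (hA : A.IsSymm) :
    RestrictsTo e b A (matInner (constMat A) (symmetrized Y)) := by
  intro x y
  have h1 : ∀ i j, MvPolynomial.eval ![⟪e, (x : Euc n)⟫, ⟪e, (y : Euc n)⟫,
      ⟪(x : Euc n), (y : Euc n)⟫] (Y i j) = ZMat b x y i j := fun i j => by
    rw [hY, Matrix.map_apply]
  have h2 : ∀ i j, MvPolynomial.eval ![⟪e, (x : Euc n)⟫, ⟪e, (y : Euc n)⟫,
      ⟪(x : Euc n), (y : Euc n)⟫] (MvPolynomial.rename (Equiv.swap (0 : Fin 3) 1) (Y i j)) =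
      ZMat b x y j i := fun i j => by
    rw [MvPolynomial.eval_rename, ← ZMat_swap, hY, Matrix.map_apply]
    congr 2
    funext l
    fin_cases l
    · simp
    · simp
    · simp [Equiv.swap_apply_of_ne_of_ne, real_inner_comm]
  have h3 : ∑ i, ∑ j, A i j * ZMat b x y j i = ∑ i, ∑ j, A i j * ZMat b x y i j := by
    rw [Finset.sum_comm]
    exact Finset.sum_congr rfl fun i _ => Finset.sum_congr rfl fun j _ => by rw [hA.apply]
  rw [matInner_eq_sum, matInner_eq_sum, map_sum]
  calc _ = ∑ i, ∑ j, (1 / 2 * (A i j * ZMat b x y i j) + 1 / 2 * (A i j * ZMat b x y j i)) := by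
        refine Finset.sum_congr rfl fun i _ => ?_
        rw [map_sum]
        refine Finset.sum_congr rfl fun j _ => ?_
        simp only [constMat, symmetrized, Matrix.map_apply, Matrix.smul_apply, Matrix.add_apply,
          map_mul, MvPolynomial.eval_C, MvPolynomial.smul_eval, map_add, h1, h2]
        ring
    _ = _ := by
        simp only [Finset.sum_add_distrib, ← Finset.mul_sum, h3]
        ring

end Zonal

end CapCode

end

/-! ### The orthogonality relations. -/

theorem proposition4p6 (n : ℕ) (hn : 3 ≤ n) (e : CapCode.Euc n) (he : ‖e‖ = 1) (d : ℕ)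
    (Y : (k : Fin (d + 1)) →
      Matrix (Fin (d - (k : ℕ) + 1)) (Fin (d - (k : ℕ) + 1)) CapCode.Poly3)
    (hY : ∀ k : Fin (d + 1), CapCode.IsZonalMatrix n e d k (Y k)) :
    (∀ (k k' : Fin (d + 1)) (i j : Fin (d - (k : ℕ) + 1)) (i' j' : Fin (d - (k' : ℕ) + 1)),
      CapCode.polyInner n (Y k i j) (Y k' i' j') =
        if k = k' ∧ (i : ℕ) = (i' : ℕ) ∧ (j : ℕ) = (j' : ℕ)
        then 1 / (CapCode.harmDim (n - 1) k : ℝ) else 0) ∧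
    (∀ (k : Fin (d + 1)) (A B : Matrix (Fin (d - (k : ℕ) + 1)) (Fin (d - (k : ℕ) + 1)) ℝ),
      A.IsSymm → B.IsSymm →
      CapCode.polyInner n
          (CapCode.matInner (CapCode.constMat A) (CapCode.symmetrized (Y k)))
          (CapCode.matInner (CapCode.constMat B) (CapCode.symmetrized (Y k))) =
        CapCode.matInner A B / (CapCode.harmDim (n - 1) k : ℝ)) ∧
    (∀ (k k' : Fin (d + 1)), k ≠ k' →
      ∀ (A : Matrix (Fin (d - (k : ℕ) + 1)) (Fin (d - (k : ℕ) + 1)) ℝ)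
        (B : Matrix (Fin (d - (k' : ℕ) + 1)) (Fin (d - (k' : ℕ) + 1)) ℝ),
      A.IsSymm → B.IsSymm →
      CapCode.polyInner n
          (CapCode.matInner (CapCode.constMat A) (CapCode.symmetrized (Y k)))
          (CapCode.matInner (CapCode.constMat B) (CapCode.symmetrized (Y k'))) = 0) := by
  choose b hb hbY using hY
  refine ⟨fun k k' i j i' j' => ?_, fun k A B hA hB => ?_, fun k k' hk A B hA hB => ?_⟩
  · by_cases hk : k = k'
    · subst hk
      rw [(hb k).polyInner_eq hn he (CapCode.restrictsTo_entry (hbY k) i j)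
        (CapCode.restrictsTo_entry (hbY k) i' j'), CapCode.matInner_single_left]
      simp only [Matrix.single_apply, Fin.val_inj, true_and, eq_comm (a := i'), eq_comm (a := j')]
      split_ifs <;> simp
    · rw [if_neg fun h => hk h.1]
      exact (hb k).polyInner_eq_zero hn he (Fin.val_ne_of_ne hk) (hb k')
        (CapCode.restrictsTo_entry (hbY k) i j) (CapCode.restrictsTo_entry (hbY k') i' j')
  · exact (hb k).polyInner_eq hn he (CapCode.restrictsTo_symmetrized (hbY k) hA)
      (CapCode.restrictsTo_symmetrized (hbY k) hB)
  · exact (hb k).polyInner_eq_zero hn he (Fin.val_ne_of_ne hk) (hb k')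
      (CapCode.restrictsTo_symmetrized (hbY k) hA) (CapCode.restrictsTo_symmetrized (hbY k') hB)
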